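/- Let $K$ be a field, let $n,m\ge 0$ and $p_1,\dots,p_m\ge 0$ be integers, let $S=K[x_1,\dots,x_n]$ be the polynomial ring with its standard grading, and let $A=K[x_1,\dots,x_n,y_1,\dots,y_m]$ be bigraded by $\deg x_i=(1,0)$ and $\deg y_j=(p_j,1)$. For a finitely generated $\mathbb Z$-graded $S$-module $N$ of Krull dimension $d$, put $H_0(N,a)=\dim_K N_a$ and $H_i(N,a)=\sum_{b\le a}H_{i-1}(N,b)$ for $i\ge 1$. The iterated Hilbert coefficients $e^i_j(N)\in\mathbb Z$ $(i\ge 0,\ 0\le j\le d+i-1)$ are defined by $$H_i(N,a)=\sum_{j=0}^{d+i-1}(-1)^j e^i_j(N)\binom{a+d+i-j-1}{d+i-j-1}\quad\text{for all } a\gg 0,$$ and one sets $e^i_j(N)=0$ for $j>d+i-1$, and $e^i_j(0)=0$ for all $i,j$. Let $M=\bigoplus_{a,b\in\mathbb Z}M_{(a,b)}$ be a finitely generated bigraded $A$-module, and for $k\in\mathbb Z$ let $M_k=\bigoplus_{a\in\mathbb Z}M_{(a,k)}$, a graded $S$-module. Then there is an integer $k_0$ such that for all $k\ge k_0$ the Krull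 dimension $\dim M_k$ is equal to a constant $\operatorname{ldim}M=\lim_{k\to\infty}\dim M_k$ (with $\dim 0=-\infty$), the coefficients $e^i_j(M_k)$ exist for all $i,j\ge 0$, and the following holds. For all $i,j\ge 0$ there is a polynomial $Q_{i,j}\in\mathbb Q[x]$ with $$e^i_j(M_k)=Q_{i,j}(k)\quad\text{for all } k\ge k_0 ,$$ such that $\deg Q_{i,j}\le m+j-1$ if $j\le \operatorname{ldim}M+i-1$, and $Q_{i,j}=0$ if $j>\operatorname{ldim}M+i-1$. Here the zero polynomial has degree $-1$. -/

import Mathlib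

open Polynomial

namespace BigradedHilbert

/-- The polynomial ring `S = K[x_1, …, x_n]`. -/
abbrev SRing (K : Type*) [Field K] (n : ℕ) := MvPolynomial (Fin n) K

/-- The polynomial ring `A = K[x_1, …, x_n, y_1, …, y_m]`. -/
abbrev ARing (K : Type*) [Field K] (n m : ℕ) := MvPolynomial (Fin n ⊕ Fin m) K

/-- The inclusion `S ⊆ A`, `x_i ↦ x_i`, as an algebra structure. -/
noncomputable instance algebraSRingARing (K : Type*) [Field K] (n m : ℕ) :
    Algebra (SRing K n) (ARing K n m) :=
  ((MvPolynomial.rename (R := K) (Sum.inl : Fin n → Fin n ⊕ Fin m)).toRingHom).toAlgebra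

/-- The bidegrees of the variables: `deg x_i = (1, 0)` and `deg y_j = (p_j, 1)`. -/
def bidegree (n : ℕ) {m : ℕ} (p : Fin m → ℕ) : Fin n ⊕ Fin m → ℤ × ℤ :=
  Sum.elim (fun _ => (1, 0)) (fun j => ((p j : ℤ), 1))

/-- The bigrading of `A`: the component of bidegree `(a, b)` is the `K`-span of the monomials of
that bidegree. -/
noncomputable abbrev bigrading (K : Type*) [Field K] (n : ℕ) {m : ℕ} (p : Fin m → ℕ) :
    ℤ × ℤ → Submodule K (ARing K n m) :=
  MvPolynomial.weightedHomogeneousSubmodule K (bidegree n p)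

section Graded

variable {K : Type*} [Field K] {N : Type*} [AddCommGroup N] [Module K N]

/-- The iterated Hilbert functions of a graded module with components `𝒩 a`:
`H_0(a) = dim_K 𝒩 a` and `H_{i+1}(a) = ∑_{b ≤ a} H_i(b)`.
(For a finitely generated module the components are finite dimensional and vanish in very negative
degrees, so that these are finite sums.) -/
noncomputable def hilbertFun (𝒩 : ℤ → Submodule K N) : ℕ → ℤ → ℕ
  | 0, a => Module.finrank K (𝒩 a)
  | i + 1, a => ∑ᶠ b ∈ Set.Iic a, hilbertFun 𝒩 i b

/-- `P` is the `i`-th Hilbert polynomial: `H_i(a) = P(a)` for all `a ≫ 0`. -/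
def IsHilbertPolynomial (𝒩 : ℤ → Submodule K N) (i : ℕ) (P : ℚ[X]) : Prop :=
  ∀ᶠ a : ℤ in Filter.atTop, (hilbertFun 𝒩 i a : ℚ) = P.eval (a : ℚ)

/-- The polynomial `binom(x + r, r) = (x + r)(x + r - 1)⋯(x + 1) / r!`. -/
noncomputable def binomPoly (r : ℕ) : ℚ[X] :=
  C ((r.factorial : ℚ)⁻¹) * (descPochhammer ℚ r).comp (X + C (r : ℚ))

/-- The Krull dimension of a finitely generated `S`-module as a natural number; the value at the
zero module (whose Krull dimension is `⊥`) is irrelevant, since all its Hilbert polynomials are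
zero. -/
noncomputable def natDim (K : Type*) [Field K] (n : ℕ) (N : Type*) [AddCommGroup N]
    [Module (SRing K n) N] : ℕ :=
  ((Module.supportDim (SRing K n) N).unbotD 0).toNat

/-- The integers `c 0, c 1, …` are the `i`-th iterated Hilbert coefficients of the graded
`S`-module `N` of Krull dimension `d`: the `i`-th Hilbert polynomial is
`∑_{j=0}^{d+i-1} (-1)^j (c j) binom(x + d+i-j-1, d+i-j-1)`, and `c j = 0` for `j > d+i-1`. -/
def IsHilbertCoeffs (n : ℕ) [Module (SRing K n) N] (𝒩 : ℤ → Submodule K N) (i : ℕ)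
    (c : ℕ → ℤ) : Prop :=
  IsHilbertPolynomial 𝒩 i
      (∑ j ∈ Finset.range (natDim K n N + i),
        C ((-1 : ℚ) ^ j * (c j : ℚ)) * binomPoly (natDim K n N + i - j - 1)) ∧
    ∀ j, natDim K n N + i ≤ j → c j = 0

open Classical in
/-- The higher iterated Hilbert coefficient `e^i_j(N)` of a graded `S`-module `N` with
components `𝒩 a`. -/
noncomputable def hilbertCoeff (n : ℕ) [Module (SRing K n) N] (𝒩 : ℤ → Submodule K N)
    (i j : ℕ) : ℤ :=
  if h : ∃ c : ℕ → ℤ, IsHilbertCoeffs n 𝒩 i c then h.choose j else 0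

end Graded

section Bigraded

variable {K : Type*} [Field K] (n : ℕ) {m : ℕ} {M : Type*} [AddCommGroup M] [Module K M]
  [Module (SRing K n) M] [Module (ARing K n m) M] [IsScalarTower K (SRing K n) M]
  [IsScalarTower (SRing K n) (ARing K n m) M]

/-- The sum `⨁_a M_(a,k)` is stable under multiplication by elements of `S`. -/
theorem smul_mem_row (p : Fin m → ℕ) (ℳ : ℤ × ℤ → Submodule K M)
    [SetLike.GradedSMul (bigrading K n p) ℳ] (k : ℤ) (s : SRing K n) :
    ∀ x ∈ (⨆ a : ℤ, ℳ (a, k)), s • x ∈ (⨆ a : ℤ, ℳ (a, k)) := by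
  induction s using MvPolynomial.induction_on with
  | C c =>
    intro x hx
    rw [← MvPolynomial.algebraMap_eq, algebraMap_smul]
    exact Submodule.smul_mem _ c hx
  | add f g hf hg =>
    intro x hx
    rw [add_smul]
    exact Submodule.add_mem _ (hf x hx) (hg x hx)
  | mul_X f t hf =>
    intro x hx
    rw [mul_smul]
    refine hf _ ?_
    induction hx using Submodule.iSup_induction' with
    | mem a x hx =>
      have hX : (MvPolynomial.X (Sum.inl t) : ARing K n m) ∈ bigrading K n p (1, 0) :=
        MvPolynomial.isWeightedHomogeneous_X K (bidegree n p) (Sum.inl t)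
      have h1 := SetLike.GradedSMul.smul_mem (B := ℳ) hX hx
      have h2 : (MvPolynomial.X t : SRing K n) • x
          = (MvPolynomial.X (Sum.inl t) : ARing K n m) • x := by
        rw [← algebraMap_smul (ARing K n m) (MvPolynomial.X t : SRing K n) x]
        congr 1
        exact MvPolynomial.rename_X _ _
      rw [h2]
      have h3 : ((1, 0) : ℤ × ℤ) +ᵥ ((a, k) : ℤ × ℤ) = (1 + a, k) := by
        simp [vadd_eq_add]
      rw [h3] at h1
      exact Submodule.mem_iSup_of_mem (1 + a) h1
    | zero => simp
    | add x y _ _ hx hy =>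
      rw [smul_add]
      exact Submodule.add_mem _ hx hy

/-- The `S`-module `M_k = ⨁_a M_(a,k)`, as an `S`-submodule of `M`. -/
noncomputable def row (p : Fin m → ℕ) (ℳ : ℤ × ℤ → Submodule K M)
    [SetLike.GradedSMul (bigrading K n p) ℳ] (k : ℤ) : Submodule (SRing K n) M where
  carrier := (⨆ a : ℤ, ℳ (a, k) : Submodule K M)
  add_mem' hx hy := Submodule.add_mem _ hx hy
  zero_mem' := Submodule.zero_mem _
  smul_mem' s x hx := smul_mem_row n p ℳ k s x hx

/-- The grading of `M_k`: its component of degree `a` is `M_(a,k)`. -/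
noncomputable def rowGrading (p : Fin m → ℕ) (ℳ : ℤ × ℤ → Submodule K M)
    [SetLike.GradedSMul (bigrading K n p) ℳ] (k a : ℤ) : Submodule K (row n p ℳ k) :=
  (ℳ (a, k)).comap ((row n p ℳ k).subtype.restrictScalars K)

/-- The limit `ldim M` of the Krull dimensions `dim M_k` of the `S`-modules `M_k` for `k → ∞`
(the sequence is eventually constant for finitely generated `M`). -/
noncomputable def ldim (p : Fin m → ℕ) (ℳ : ℤ × ℤ → Submodule K M)
    [SetLike.GradedSMul (bigrading K n p) ℳ] : WithBot ℕ∞ :=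
  Filter.limsup (fun k : ℤ => Module.supportDim (SRing K n) (row n p ℳ k)) Filter.atTop

end Bigraded

end BigradedHilbert

/-! Work with generating functions: multiplication by `1 - s^w` is the difference operator
`shiftDiff w` on coefficient functions. Put F(a,k) = dim M_(a,k).

By Hilbert–Serre (`finite_support_shiftDiffs_finrank`), (1-s)^n ∏(1 - s^{p_j} t) turns F into a
function of finite support. Rows vanish for a ≪ 0, so the factor (1-s)^n can be cancelled in each
row, and for k ≫ 0 the rows satisfy the linear recurrence with characteristic factors 1 - s^{p_j} t
(`shiftDiffs_eq_zero_of_finite_support`).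

Once k exceeds the degrees of all generators, M_k = ∑ y_j M_{k-1}, so the annihilators of the rows
increase and stabilize; hence dim M_k is eventually a constant (`exists_supportDim_row_eq`). If M_k
is nonzero for k ≫ 0, call this constant d; the zero case is separate. For one graded S-module of
dimension d, (1-s)^d times its Hilbert series is a Laurent polynomial: Noether normalization bounds
the growth of the summed Hilbert function by a polynomial of degree d
(`finite_support_shiftDiff_iterate_natDim`).

Let q_k be this numerator for M_k. Expanding it around s = 1 gives e^i_j(M_k) = ∑_a q_k(a)
binom(a,j) for j < d+i, independently of i (`isHilbertCoeffs_of_finite_support`). The q_k inherit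
the recurrence of the rows. Removing one factor 1 - s^p t expresses the difference in k of the j-th
moment through polynomials of smaller degree, by Vandermonde; each factor costs one summation.
Induction on the number of factors and on j gives degree < m + j (`exists_polynomial_binomMoment`).
-/

namespace BigradedHilbert

/-! ### Difference operators on an abelian group. -/

section ShiftDiff

variable {G : Type*} [AddCommGroup G]

/-- The difference operator `f ↦ f - f(· - w)`. -/
def shiftDiff (w : G) (f : G → ℤ) : G → ℤ := fun g => f g - f (g - w)

/-- The composition of the difference operators of the elements of a list. -/
def shiftDiffs (l : List G) (f : G → ℤ) : G → ℤ := l.foldr shiftDiff f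

@[simp]
theorem shiftDiffs_nil (f : G → ℤ) : shiftDiffs [] f = f := rfl

theorem shiftDiffs_cons (w : G) (l : List G) (f : G → ℤ) :
    shiftDiffs (w :: l) f = shiftDiff w (shiftDiffs l f) := rfl

theorem shiftDiffs_append (l l' : List G) (f : G → ℤ) :
    shiftDiffs (l ++ l') f = shiftDiffs l (shiftDiffs l' f) := by
  simp [shiftDiffs, List.foldr_append]

theorem shiftDiff_comm (v w : G) (f : G → ℤ) :
    shiftDiff v (shiftDiff w f) = shiftDiff w (shiftDiff v f) := by
  funext g
  simp only [shiftDiff, sub_right_comm g v w]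
  ring

theorem shiftDiffs_shiftDiff (l : List G) (w : G) (f : G → ℤ) :
    shiftDiffs l (shiftDiff w f) = shiftDiff w (shiftDiffs l f) := by
  induction l with
  | nil => rfl
  | cons v l ih => rw [shiftDiffs_cons, ih, shiftDiffs_cons, shiftDiff_comm]

theorem shiftDiffs_comm (l l' : List G) (f : G → ℤ) :
    shiftDiffs l (shiftDiffs l' f) = shiftDiffs l' (shiftDiffs l f) := by
  induction l with
  | nil => rfl
  | cons w l ih => rw [shiftDiffs_cons, ih, shiftDiffs_cons, shiftDiffs_shiftDiff]

theorem shiftDiffs_sub_translate (l : List G) (w : G) (f f' : G → ℤ) :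
    shiftDiffs l (fun g => f g - f' (g - w)) =
      fun g => shiftDiffs l f g - shiftDiffs l f' (g - w) := by
  induction l with
  | nil => rfl
  | cons v l ih =>
    rw [shiftDiffs_cons, ih]
    funext g
    simp only [shiftDiffs_cons, shiftDiff, sub_right_comm g v w]
    ring

end ShiftDiff

/-! ### Cancelling powers of 1 - s. -/

section Difference

/-- A function with zero differences is constant, and vanishing on the far left makes the constant
0. Thus 1 - s is cancellable on series bounded below. -/
theorem eq_zero_of_shiftDiff_eq_zero {f : ℤ → ℤ} {a₀ : ℤ} (h0 : ∀ a < a₀, f a = 0)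
    (h : shiftDiff 1 f = 0) : f = 0 := by
  have key : ∀ a, a₀ - 1 ≤ a → f a = 0 := by
    intro a ha
    induction a, ha using Int.leInduction with
    | base => exact h0 _ (by omega)
    | succ b _ ih =>
      have := congrFun h (b + 1)
      simp only [shiftDiff, add_sub_cancel_right, Pi.zero_apply] at this
      omega
  funext a
  by_cases ha : a < a₀
  · exact h0 a ha
  · exact key a (by omega)

theorem shiftDiff_iterate_eq_zero_of_lt {f : ℤ → ℤ} {a₀ : ℤ} (h0 : ∀ a < a₀, f a = 0) (r : ℕ) :
    ∀ a < a₀, (shiftDiff 1)^[r] f a = 0 := by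
  induction r generalizing f with
  | zero => exact h0
  | succ r ih =>
    refine ih fun a ha => ?_
    rw [shiftDiff, h0 a ha, h0 (a - 1) (by omega), sub_zero]

theorem eq_zero_of_shiftDiff_iterate_eq_zero {f : ℤ → ℤ} {a₀ : ℤ} (h0 : ∀ a < a₀, f a = 0)
    (r : ℕ) (h : (shiftDiff 1)^[r] f = 0) : f = 0 := by
  induction r with
  | zero => exact h
  | succ r ih =>
    rw [Function.iterate_succ_apply'] at h
    exact ih (eq_zero_of_shiftDiff_eq_zero (shiftDiff_iterate_eq_zero_of_lt h0 r) h)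

theorem shiftDiff_iterate_sub (f g : ℤ → ℤ) (r : ℕ) :
    (shiftDiff 1)^[r] (f - g) = (shiftDiff 1)^[r] f - (shiftDiff 1)^[r] g := by
  induction r generalizing f g with
  | zero => rfl
  | succ r ih =>
    simp only [Function.iterate_succ_apply]
    rw [← ih]
    congr 1
    funext a
    simp only [shiftDiff, Pi.sub_apply]
    ring

end Difference

/-! ### Binomial polynomials and finite differences. -/

section BinomPoly

theorem eval_binomPoly (r : ℕ) (a : ℤ) :
    (binomPoly r).eval (a : ℚ) = ((Ring.choose (a + r) r : ℤ) : ℚ) := by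
  have h : ((Ring.choose (a + r) r : ℤ) : ℚ) = Ring.choose ((a : ℚ) + r) r := by
    have := Ring.map_choose (Int.castRingHom ℚ) (a + r) r
    simpa using this
  have h2 : (descPochhammer ℤ r).smeval ((a : ℚ) + r) = (descPochhammer ℚ r).eval ((a : ℚ) + r) := by
    rw [← aeval_eq_smeval, aeval_def, eval₂_eq_eval_map, descPochhammer_map]
  rw [h, Ring.choose_eq_smul, h2]
  simp [binomPoly]

theorem degree_binomPoly (r : ℕ) : (binomPoly r).degree = r := by
  have h1 : (C ((r.factorial : ℚ)⁻¹)).degree = 0 :=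
    degree_C (inv_ne_zero (by exact_mod_cast r.factorial_ne_zero))
  have h2 : ((descPochhammer ℚ r).comp (X + C (r : ℚ))).degree = r := by
    rw [degree_eq_natDegree]
    · rw [natDegree_comp, descPochhammer_natDegree, natDegree_X_add_C, mul_one]
    · intro h
      rw [comp_eq_zero_iff] at h
      rcases h with h | ⟨-, h⟩
      · exact (monic_descPochhammer ℚ r).ne_zero h
      · have := congrArg natDegree h
        rw [natDegree_X_add_C, natDegree_C] at this
        omega
  rw [binomPoly, degree_mul, h1, h2, zero_add]

/-- The binomial polynomials as a polynomial sequence. -/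
noncomputable def binomSequence : Polynomial.Sequence ℚ := ⟨binomPoly, degree_binomPoly⟩

theorem span_binomPoly (N : ℕ) :
    Submodule.span ℚ (binomPoly '' Set.Iio N) = degreeLT ℚ N :=
  binomSequence.span_degreeLT fun i _ =>
    (leadingCoeff_ne_zero.mpr (binomSequence.ne_zero i)).isUnit

theorem eval_binomPoly_succ_sub (r : ℕ) (a : ℤ) :
    (binomPoly (r + 1)).eval (a : ℚ) - (binomPoly (r + 1)).eval ((a - 1 : ℤ) : ℚ) =
      (binomPoly r).eval (a : ℚ) := by
  rw [eval_binomPoly, eval_binomPoly, eval_binomPoly]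
  have h := Ring.choose_succ_succ (a + r) r
  have e1 : a + ((r + 1 : ℕ) : ℤ) = a + r + 1 := by push_cast; ring
  have e2 : a - 1 + ((r + 1 : ℕ) : ℤ) = a + r := by push_cast; ring
  rw [e1, e2, h]
  push_cast
  ring

/-- By Pascal's rule the antidifference of one binomial polynomial is the next one, and these
polynomials span. -/
theorem exists_antidifference {N : ℕ} {P : ℚ[X]} (hP : P.degree < N) :
    ∃ Q : ℚ[X], Q.degree < (N + 1 : ℕ) ∧
      ∀ a : ℤ, Q.eval (a : ℚ) - Q.eval ((a - 1 : ℤ) : ℚ) = P.eval (a : ℚ) := by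
  rw [← mem_degreeLT, ← span_binomPoly] at hP
  induction hP using Submodule.span_induction with
  | mem x hx =>
    obtain ⟨r, hr, rfl⟩ := hx
    refine ⟨binomPoly (r + 1), ?_, eval_binomPoly_succ_sub r⟩
    rw [degree_binomPoly]
    have : r + 1 < N + 1 := by simpa using hr
    exact_mod_cast this
  | zero => exact ⟨0, by simp, by simp⟩
  | add x y _ _ hx hy =>
    obtain ⟨Q, hQ, hQ'⟩ := hx
    obtain ⟨R, hR, hR'⟩ := hy
    refine ⟨Q + R, (degree_add_le _ _).trans_lt (max_lt hQ hR), fun a => ?_⟩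
    rw [eval_add, eval_add, eval_add, ← hQ', ← hR']
    ring
  | smul c x _ hx =>
    obtain ⟨Q, hQ, hQ'⟩ := hx
    refine ⟨c • Q, (degree_smul_le _ _).trans_lt hQ, fun a => ?_⟩
    rw [eval_smul, eval_smul, eval_smul, ← hQ', smul_eq_mul, smul_eq_mul, smul_eq_mul]
    ring

theorem exists_difference {N : ℕ} {P : ℚ[X]} (hP : P.degree < (N + 1 : ℕ)) :
    ∃ Q : ℚ[X], Q.degree < N ∧
      ∀ a : ℤ, P.eval (a : ℚ) - P.eval ((a - 1 : ℤ) : ℚ) = Q.eval (a : ℚ) := by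
  rw [← mem_degreeLT, ← span_binomPoly] at hP
  induction hP using Submodule.span_induction with
  | mem x hx =>
    obtain ⟨r, hr, rfl⟩ := hx
    rcases r with _ | r
    · exact ⟨0, by simp, by simp [binomPoly]⟩
    · refine ⟨binomPoly r, ?_, eval_binomPoly_succ_sub r⟩
      rw [degree_binomPoly]
      have : r < N := by simpa using hr
      exact_mod_cast this
  | zero => exact ⟨0, by simp, by simp⟩
  | add x y _ _ hx hy =>
    obtain ⟨Q, hQ, hQ'⟩ := hx
    obtain ⟨R, hR, hR'⟩ := hy
    refine ⟨Q + R, (degree_add_le _ _).trans_lt (max_lt hQ hR), fun a => ?_⟩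
    rw [eval_add, eval_add, eval_add, ← hQ', ← hR']
    ring
  | smul c x _ hx =>
    obtain ⟨Q, hQ, hQ'⟩ := hx
    refine ⟨c • Q, (degree_smul_le _ _).trans_lt hQ, fun a => ?_⟩
    rw [eval_smul, eval_smul, eval_smul, ← hQ', smul_eq_mul, smul_eq_mul, smul_eq_mul]
    ring

/-- A function whose differences are polynomial from some point on is itself polynomial. -/
theorem exists_polynomial_of_difference {f : ℤ → ℤ} {a₁ : ℤ} {N : ℕ} {P : ℚ[X]}
    (hP : P.degree < N) (h : ∀ a > a₁, ((f a - f (a - 1) : ℤ) : ℚ) = P.eval (a : ℚ)) :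
    ∃ Q : ℚ[X], Q.degree < (N + 1 : ℕ) ∧ ∀ a ≥ a₁, (f a : ℚ) = Q.eval (a : ℚ) := by
  obtain ⟨Q, hQ, hQ'⟩ := exists_antidifference hP
  refine ⟨Q + C ((f a₁ : ℚ) - Q.eval (a₁ : ℚ)), ?_, fun a ha => ?_⟩
  · refine (degree_add_le _ _).trans_lt (max_lt hQ (degree_C_le.trans_lt ?_))
    exact_mod_cast Nat.succ_pos N
  · induction a, ha using Int.leInduction with
    | base => simp
    | succ b hb ih =>
      have h1 := h (b + 1) (by omega)
      have h2 := hQ' (b + 1)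
      rw [add_sub_cancel_right] at h1 h2
      rw [← h2] at h1
      push_cast at h1 ih ⊢
      rw [eval_add, eval_C] at ih ⊢
      linarith

theorem exists_polynomial_of_shiftDiff_iterate {f : ℤ → ℤ} {r : ℕ}
    (h : ∀ᶠ a in Filter.atTop, (shiftDiff 1)^[r] f a = 0) :
    ∃ P : ℚ[X], ∀ᶠ a : ℤ in Filter.atTop, (f a : ℚ) = P.eval (a : ℚ) := by
  induction r generalizing f with
  | zero => exact ⟨0, by filter_upwards [h] with a ha using by simpa using ha⟩
  | succ r ih =>
    obtain ⟨P, hP⟩ := ih (f := shiftDiff 1 f) h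
    obtain ⟨a₁, ha⟩ := Filter.eventually_atTop.mp hP
    obtain ⟨Q, -, hQ⟩ := exists_polynomial_of_difference (N := P.natDegree + 1) (a₁ := a₁)
      (degree_le_natDegree.trans_lt (by exact_mod_cast Nat.lt_succ_self _))
      fun a h => ha a (le_of_lt h)
    exact ⟨Q, Filter.eventually_atTop.mpr ⟨a₁, hQ⟩⟩

theorem shiftDiff_iterate_eventually_eq_zero {f : ℤ → ℤ} {N : ℕ} {P : ℚ[X]} (hP : P.degree < N)
    (h : ∀ᶠ a : ℤ in Filter.atTop, (f a : ℚ) = P.eval (a : ℚ)) :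
    ∀ᶠ a in Filter.atTop, (shiftDiff 1)^[N] f a = 0 := by
  induction N generalizing f P with
  | zero =>
    have : P = 0 := by simpa using hP
    subst this
    filter_upwards [h] with a ha using by simpa using ha
  | succ N ih =>
    obtain ⟨Q, hQ, hQ'⟩ := exists_difference hP
    refine ih (f := shiftDiff 1 f) hQ ?_
    have h' := (Filter.tendsto_atTop_add_const_right Filter.atTop (-1 : ℤ)
      Filter.tendsto_id).eventually h
    filter_upwards [h, h'] with a h1 h2
    rw [← hQ', shiftDiff]
    push_cast at h2 ⊢
    rw [h1, sub_eq_add_neg a 1, sub_eq_add_neg (a : ℚ) 1]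
    congr 1

/-- Otherwise |P/W| would tend to infinity, contradicting the bound by 1. -/
theorem degree_le_of_abs_le {P W : ℚ[X]} (hW : W ≠ 0)
    (h : ∀ᶠ a : ℤ in Filter.atTop, |P.eval (a : ℚ)| ≤ |W.eval (a : ℚ)|) : P.degree ≤ W.degree := by
  by_contra! hlt
  have h1 := (abs_div_tendsto_atTop_atTop_of_degree_gt P W hlt hW).comp
    (tendsto_intCast_atTop_atTop (R := ℚ))
  obtain ⟨a, h2, h3⟩ := ((h1.eventually_gt_atTop 1).and h).exists
  simp only [Function.comp_apply, abs_div] at h2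
  exact absurd h2 (not_lt.mpr (div_le_one_of_le₀ h3 (abs_nonneg _)))

/-- The binomial polynomials involved have pairwise distinct degrees, hence are linearly
independent. -/
theorem binomPoly_sum_injective {r : ℕ} {c c' : ℕ → ℤ}
    (h : ∑ j ∈ Finset.range r, C ((-1 : ℚ) ^ j * (c j : ℚ)) * binomPoly (r - j - 1) =
      ∑ j ∈ Finset.range r, C ((-1 : ℚ) ^ j * (c' j : ℚ)) * binomPoly (r - j - 1)) :
    ∀ j < r, c j = c' j := by
  have hli := binomSequence.linearIndependent
  have hli' : LinearIndependent ℚ (fun j : Fin r => binomPoly (r - j - 1)) :=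
    hli.comp (fun j : Fin r => r - j - 1) fun i j hij => by
      ext
      have := i.2; have := j.2
      simp only at hij
      omega
  rw [Finset.sum_range, Finset.sum_range, ← sub_eq_zero, ← Finset.sum_sub_distrib] at h
  intro j hj
  have := Fintype.linearIndependent_iff.mp hli'
    (fun j => (-1 : ℚ) ^ (j : ℕ) * (c j : ℚ) - (-1 : ℚ) ^ (j : ℕ) * (c' j : ℚ)) (by
      rw [← h]
      refine Finset.sum_congr rfl fun i _ => ?_
      rw [smul_eq_C_mul, C_sub, sub_mul]) ⟨j, hj⟩
  simp only [← mul_sub, mul_eq_zero, pow_eq_zero_iff', neg_eq_zero, one_ne_zero, false_and,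
    false_or, sub_eq_zero] at this
  exact_mod_cast this

theorem eq_of_eventually_eval_eq {P Q : ℚ[X]}
    (h : ∀ᶠ a : ℤ in Filter.atTop, P.eval (a : ℚ) = Q.eval (a : ℚ)) : P = Q := by
  refine eq_of_infinite_eval_eq P Q ?_
  obtain ⟨a₁, ha⟩ := Filter.eventually_atTop.mp h
  refine ((Set.Ici_infinite a₁).image (f := fun a : ℤ => (a : ℚ))
    (Int.cast_injective.injOn)).mono ?_
  rintro _ ⟨a, h, rfl⟩
  exact ha a h

end BinomPoly

/-! ### Binomial moments and linear recurrences. -/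

section BinomMoment

/-- The `j`-th binomial moment of a function of finite support; up to sign these are the Taylor
coefficients at `1` of the Laurent polynomial with coefficients `q`. -/
noncomputable def binomMoment (q : ℤ → ℤ) (j : ℕ) : ℤ := ∑ᶠ a, q a * Ring.choose a j

theorem binomMoment_eq_sum {q : ℤ → ℤ} {s : Finset ℤ} (hs : q.support ⊆ s) (j : ℕ) :
    binomMoment q j = ∑ a ∈ s, q a * Ring.choose a j :=
  finsum_eq_sum_of_support_subset _ fun a ha => hs fun h0 => ha (by simp [h0])

theorem binomMoment_zero (j : ℕ) : binomMoment 0 j = 0 := by simp [binomMoment]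

theorem binomMoment_sub {q q' : ℤ → ℤ} (hq : q.support.Finite) (hq' : q'.support.Finite) (j : ℕ) :
    binomMoment (fun a => q a - q' a) j = binomMoment q j - binomMoment q' j := by
  have h : (q.support ∪ q'.support).Finite := hq.union hq'
  have hs : q.support ⊆ h.toFinset := by simp
  have hs' : q'.support ⊆ h.toFinset := by simp
  have hs'' : (fun a => q a - q' a).support ⊆ h.toFinset := by
    rw [Set.Finite.coe_toFinset]
    exact Function.support_sub q q'
  rw [binomMoment_eq_sum hs, binomMoment_eq_sum hs', binomMoment_eq_sum hs'',
    ← Finset.sum_sub_distrib]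
  simp only [sub_mul]

/-- Reindexing by b = a - p leaves binom(b + p, j), which Vandermonde's identity expands. -/
theorem binomMoment_translate {q : ℤ → ℤ} (hq : q.support.Finite) (p : ℤ) (j : ℕ) :
    binomMoment (fun a => q (a - p)) j =
      ∑ x ∈ Finset.HasAntidiagonal.antidiagonal j, Ring.choose p x.2 * binomMoment q x.1 := by
  have h1 : binomMoment (fun a => q (a - p)) j = ∑ᶠ b, q b * Ring.choose (b + p) j := by
    rw [binomMoment, ← finsum_comp_equiv (Equiv.addRight p)]
    simp
  have hs : q.support ⊆ hq.toFinset := by simp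
  rw [h1, finsum_eq_sum_of_support_subset (s := hq.toFinset) _
    fun a ha => hs fun h0 => ha (by simp [h0])]
  simp only [binomMoment_eq_sum hs, Finset.mul_sum]
  rw [Finset.sum_comm]
  refine Finset.sum_congr rfl fun b _ => ?_
  rw [Ring.add_choose_eq j (Commute.all b p), Finset.mul_sum]
  refine Finset.sum_congr rfl fun x _ => ?_
  ring

theorem support_translate_finite {q : ℤ → ℤ} (hq : q.support.Finite) (p : ℤ) :
    (fun a => q (a - p)).support.Finite :=
  hq.preimage (f := fun a => a - p) (sub_left_injective.injOn)

/-- If the rows of `f` satisfy the linear recurrence with characteristic factors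
`1 - s ^ p t`, `p ∈ l`, then their binomial moments are eventually polynomial. -/
theorem exists_polynomial_binomMoment (l : List ℕ) {f : ℤ × ℤ → ℤ} {k₁ : ℤ}
    (hfin : ∀ k ≥ k₁, (fun a => f (a, k)).support.Finite)
    (hrec : ∀ k ≥ k₁, ∀ a, shiftDiffs (l.map fun p : ℕ => ((p : ℤ), (1 : ℤ))) f (a, k) = 0) :
    ∃ k₂ ≥ k₁, ∀ j, ∃ Q : ℚ[X], Q.degree < (l.length + j : ℕ) ∧
      ∀ k ≥ k₂, (binomMoment (fun a => f (a, k)) j : ℚ) = Q.eval (k : ℚ) := by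
  induction l generalizing f k₁ with
  | nil =>
    refine ⟨k₁, le_rfl, fun j => ⟨0, by simp, fun k hk => ?_⟩⟩
    have : (fun a => f (a, k)) = 0 := funext fun a => hrec k hk a
    simp [this, binomMoment_zero]
  | cons p l ih =>
    have hg : ∀ k, (fun a => shiftDiff ((p : ℤ), (1 : ℤ)) f (a, k)) =
        fun a => f (a, k) - f (a - p, k - 1) := fun k => rfl
    obtain ⟨K, hK, hQ⟩ := ih (f := shiftDiff ((p : ℤ), (1 : ℤ)) f) (k₁ := k₁ + 1)
      (fun k hk => by
        rw [hg]
        exact ((hfin k (by omega)).union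
          (support_translate_finite (hfin (k - 1) (by omega)) p)).subset
            (Function.support_sub _ _))
      (fun k hk a => by
        rw [shiftDiffs_shiftDiff]
        exact hrec k (by omega) a)
    refine ⟨K, by omega, fun j => ?_⟩
    induction j using Nat.strong_induction_on with
    | _ j IH =>
      choose! R hR hR' using IH
      obtain ⟨Q, hQd, hQe⟩ := hQ j
      -- The right-hand side of m_j(k) - m_j(k-1) = P(k), where m_j is the j-th moment of row k: the
      -- j-th moment of the differenced family plus the Vandermonde terms of index below j, taken at
      -- k - 1. The term x = j is the one moved to the left.
      let P : ℚ[X] := Q + ∑ x ∈ Finset.range j,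
        C ((Ring.choose (p : ℤ) (j - x) : ℤ) : ℚ) * (R x).comp (X - C 1)
      have hP : P.degree < (l.length + j : ℕ) := by
        refine (degree_add_le _ _).trans_lt (max_lt hQd ?_)
        refine (degree_sum_le _ _).trans_lt ((Finset.sup_lt_iff (WithBot.bot_lt_coe _)).mpr ?_)
        intro x hx
        rw [Finset.mem_range] at hx
        have h1 : ((R x).comp (X - C 1)).degree < (l.length + j : ℕ) := by
          by_cases h0 : R x = 0
          · rw [h0, zero_comp, degree_zero]
            exact WithBot.bot_lt_coe _
          · refine (degree_lt_iff_coeff_zero _ _).mpr fun i hi => coeff_eq_zero_of_natDegree_lt ?_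
            rw [natDegree_comp, natDegree_X_sub_C, mul_one]
            have := (natDegree_lt_iff_degree_lt h0).mpr (hR x hx)
            simp only [List.length_cons] at this
            omega
        refine lt_of_le_of_lt ?_ h1
        rw [← smul_eq_C_mul]
        exact degree_smul_le _ _
      -- Summation starts at `K` itself, so the threshold does not grow with j and one bound serves
      -- all moments.
      have := exists_polynomial_of_difference (f := fun k => binomMoment (fun a => f (a, k)) j)
        (a₁ := K) hP (fun k hk => by
          have h1 := hQe k (by omega)
          rw [hg, binomMoment_sub (hfin k (by omega))
            (support_translate_finite (hfin (k - 1) (by omega)) p),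
            binomMoment_translate (hfin (k - 1) (by omega)),
            Finset.Nat.sum_antidiagonal_eq_sum_range_succ_mk, Finset.sum_range_succ] at h1
          simp only [Nat.sub_self, Ring.choose_zero_right, one_mul] at h1
          simp only [P, eval_add, ← h1, eval_finsetSum, eval_mul, eval_C, eval_comp, eval_sub,
            eval_X]
          have h2 : ∀ x ∈ Finset.range j, ((Ring.choose (p : ℤ) (j - x) : ℤ) : ℚ) *
              (R x).eval ((k : ℚ) - 1) = ((Ring.choose (p : ℤ) (j - x) : ℤ) : ℚ) *
              (binomMoment (fun a => f (a, k - 1)) x : ℤ) := fun x hx => by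
            rw [hR' x (Finset.mem_range.mp hx) (k - 1) (by omega)]
            push_cast
            rfl
          rw [Finset.sum_congr rfl h2]
          push_cast
          ring)
      obtain ⟨Q', hQ', hQ''⟩ := this
      refine ⟨Q', hQ'.trans_le ?_, hQ''⟩
      rw [List.length_cons]
      exact_mod_cast (by omega : l.length + j + 1 ≤ l.length + 1 + j)

end BinomMoment

/-! ### From the numerator of a series to its eventual values. -/

section Expansion

/-- This reflects the expansion s^b = ∑ (-1)^j binom(b,j) (1-s)^j, divided by (1-s)^{r+1}. By
Pascal's rule and induction on r, the difference of the two sides does not depend on b, and it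
vanishes at b = 0. -/
theorem choose_sub_add_eq_sum (x b : ℤ) (r : ℕ) :
    Ring.choose (x - b + r) r =
      ∑ j ∈ Finset.range (r + 1),
        (-1) ^ j * Ring.choose b j * Ring.choose (x + (r - j : ℕ)) (r - j) := by
  induction r generalizing b with
  | zero => simp
  | succ r ih =>
    have step : ∀ b : ℤ,
        (Ring.choose (x - b + (r + 1 : ℕ)) (r + 1) - ∑ j ∈ Finset.range (r + 1 + 1),
          (-1) ^ j * Ring.choose b j * Ring.choose (x + (r + 1 - j : ℕ)) (r + 1 - j)) =
        (Ring.choose (x - (b + 1) + (r + 1 : ℕ)) (r + 1) - ∑ j ∈ Finset.range (r + 1 + 1),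
          (-1) ^ j * Ring.choose (b + 1) j *
            Ring.choose (x + (r + 1 - j : ℕ)) (r + 1 - j)) := by
      intro b
      have e1 : x - b + (r + 1 : ℕ) = (x - b + r) + 1 := by push_cast; ring
      have e2 : x - (b + 1) + (r + 1 : ℕ) = x - b + r := by push_cast; ring
      rw [e1, e2, Ring.choose_succ_succ, ih b]
      rw [Finset.sum_range_succ' (fun j => (-1) ^ j * Ring.choose b j *
        Ring.choose (x + (r + 1 - j : ℕ)) (r + 1 - j)),
        Finset.sum_range_succ' (fun j => (-1) ^ j * Ring.choose (b + 1) j *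
        Ring.choose (x + (r + 1 - j : ℕ)) (r + 1 - j))]
      simp only [Ring.choose_succ_succ b, Ring.choose_zero_right, Nat.reduceSubDiff, mul_add,
        add_mul, Finset.sum_add_distrib, pow_succ]
      simp only [mul_neg, mul_one, neg_mul, Finset.sum_neg_distrib]
      ring
    have h0 : Ring.choose (x - 0 + (r + 1 : ℕ)) (r + 1) = ∑ j ∈ Finset.range (r + 1 + 1),
          (-1) ^ j * Ring.choose 0 j * Ring.choose (x + (r + 1 - j : ℕ)) (r + 1 - j) := by
      rw [Finset.sum_range_succ']
      simp [Ring.choose_zero_succ]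
    rw [← sub_eq_zero]
    induction b using Int.induction_on with
    | zero => rw [sub_eq_zero]; exact h0
    | succ i hi => rw [← step, hi]
    | pred i hi => rw [step, sub_add_cancel, hi]

/-- The coefficients of the Laurent series of `(1 - s) ^ (-r)`. -/
def invOneSubPowCoeff (r : ℕ) (a : ℤ) : ℤ := if 0 ≤ a then Nat.multichoose r a.toNat else 0

theorem invOneSubPowCoeff_sub (r : ℕ) (a : ℤ) :
    invOneSubPowCoeff (r + 1) a - invOneSubPowCoeff (r + 1) (a - 1) = invOneSubPowCoeff r a := by
  rcases lt_trichotomy a 0 with h | rfl | h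
  · simp [invOneSubPowCoeff, show ¬ 0 ≤ a by omega, show ¬ 1 ≤ a by omega]
  · simp [invOneSubPowCoeff]
  · obtain ⟨c, rfl⟩ : ∃ c : ℕ, a = c + 1 := ⟨(a - 1).toNat, by omega⟩
    have e : ((c : ℤ) + 1).toNat = c + 1 := by omega
    simp only [invOneSubPowCoeff, add_sub_cancel_right, e, Int.toNat_natCast,
      show (0 : ℤ) ≤ (c : ℤ) + 1 by omega, show (0 : ℤ) ≤ (c : ℤ) by omega, if_true,
      Nat.multichoose_succ_succ]
    push_cast
    ring

theorem invOneSubPowCoeff_of_nonneg (r : ℕ) {a : ℤ} (ha : 0 ≤ a) :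
    invOneSubPowCoeff (r + 1) a = Ring.choose (a + r) r := by
  lift a to ℕ using ha
  rw [invOneSubPowCoeff, if_pos (by omega), Int.toNat_natCast, Nat.multichoose_eq,
    ← Nat.cast_add, Ring.choose_natCast, Nat.choose_symm_of_eq_add]
  · congr 2
    omega
  · omega

/-- If `(1 - s) ^ r ∑ f(a) s ^ a` is a Laurent polynomial, then `f` is eventually given by its
binomial moments. -/
theorem eventually_eq_eval_sum {f : ℤ → ℤ} {a₀ : ℤ} (h0 : ∀ a < a₀, f a = 0) (r : ℕ)
    (hfin : ((shiftDiff 1)^[r] f).support.Finite) :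
    ∀ᶠ a : ℤ in Filter.atTop, (f a : ℚ) = (∑ j ∈ Finset.range r,
      C ((-1 : ℚ) ^ j * ((binomMoment ((shiftDiff 1)^[r] f) j : ℤ) : ℚ)) *
        binomPoly (r - j - 1)).eval (a : ℚ) := by
  set q := (shiftDiff 1)^[r] f with hq
  set s := hfin.toFinset with hs
  have hsub : q.support ⊆ s := by simp [hs]
  -- The coefficients of q(s) / (1-s)^t.
  let S : ℕ → ℤ → ℤ := fun t a => ∑ b ∈ s, q b * invOneSubPowCoeff t (a - b)
  have hS0 : S 0 = q := by
    funext a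
    simp only [S]
    rw [Finset.sum_eq_single a]
    · simp [invOneSubPowCoeff]
    · intro b _ hb
      rw [invOneSubPowCoeff]
      split_ifs with h
      · obtain ⟨c, hc⟩ : ∃ c : ℕ, (a - b).toNat = c + 1 := ⟨(a - b).toNat - 1, by omega⟩
        simp [hc]
      · simp
    · intro ha
      have : q a = 0 := by
        by_contra h
        exact ha (hsub h)
      simp [this]
  have hSsucc : ∀ t, shiftDiff 1 (S (t + 1)) = S t := fun t => by
    funext a
    simp only [S, shiftDiff, ← Finset.sum_sub_distrib, ← mul_sub]
    refine Finset.sum_congr rfl fun b _ => ?_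
    rw [← invOneSubPowCoeff_sub t (a - b), sub_right_comm a 1 b]
  have hSr : ∀ t, (shiftDiff 1)^[t] (S t) = q := fun t => by
    induction t with
    | zero => exact hS0
    | succ t ih => rw [Function.iterate_succ_apply, hSsucc, ih]
  obtain ⟨lo, hlo⟩ := s.bddBelow
  obtain ⟨hi, hhi⟩ := s.bddAbove
  -- Both functions vanish on the far left and have the same r-th difference.
  have hfS : f = S r := by
    rw [← sub_eq_zero]
    refine eq_zero_of_shiftDiff_iterate_eq_zero (a₀ := min a₀ lo) ?_ r ?_
    · intro a ha
      rw [lt_min_iff] at ha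
      rw [Pi.sub_apply, h0 a ha.1, zero_sub, neg_eq_zero]
      refine Finset.sum_eq_zero fun b hb => ?_
      have := hlo hb
      rw [invOneSubPowCoeff, if_neg (by omega), mul_zero]
    · rw [shiftDiff_iterate_sub, hSr, ← hq, sub_self]
  -- To the right of the support of `q` every a - b is nonnegative, so the coefficients of the power
  -- of 1 - s are given by binomial polynomials.
  filter_upwards [Filter.eventually_gt_atTop hi] with a ha
  rw [hfS]
  rcases r with _ | r
  · rw [hS0]
    have : q a = 0 := by
      by_contra h
      exact absurd (hhi (hsub h)) (by omega)
    simp [this]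
  · rw [eval_finsetSum]
    simp only [eval_mul, eval_C, eval_binomPoly, S, binomMoment_eq_sum hsub]
    have h1 : ∀ b ∈ s, q b * invOneSubPowCoeff (r + 1) (a - b) =
        ∑ j ∈ Finset.range (r + 1), (-1) ^ j * (q b * Ring.choose b j) *
          Ring.choose (a + (r - j : ℕ)) (r - j) := fun b hb => by
      have := hhi hb
      rw [invOneSubPowCoeff_of_nonneg r (by omega), choose_sub_add_eq_sum, Finset.mul_sum]
      refine Finset.sum_congr rfl fun j _ => ?_
      ring
    rw [Finset.sum_congr rfl h1, Finset.sum_comm]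
    push_cast
    refine Finset.sum_congr rfl fun j hj => ?_
    rw [Finset.mul_sum, Finset.sum_mul]
    rw [show r + 1 - j - 1 = r - j by omega]

end Expansion

/-! ### Iterated Hilbert functions and their coefficients. -/

section HilbertFun

variable {K : Type*} [Field K] {N : Type*} [AddCommGroup N] [Module K N]

theorem hilbertFun_eq_zero {𝒩 : ℤ → Submodule K N} {a₀ : ℤ} (h0 : ∀ a < a₀, 𝒩 a = ⊥) (i : ℕ) :
    ∀ a < a₀, hilbertFun 𝒩 i a = 0 := by
  induction i with
  | zero =>
    intro a ha
    rw [hilbertFun, h0 a ha, finrank_bot]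
  | succ i ih =>
    intro a ha
    rw [hilbertFun]
    refine finsum_mem_eq_zero_of_forall_eq_zero fun b hb => ih b ?_
    exact lt_of_le_of_lt hb ha

theorem hilbertFun_succ_eq_sum {𝒩 : ℤ → Submodule K N} {a₀ : ℤ} (h0 : ∀ a < a₀, 𝒩 a = ⊥)
    (i : ℕ) (a : ℤ) :
    hilbertFun 𝒩 (i + 1) a = ∑ b ∈ Finset.Icc a₀ a, hilbertFun 𝒩 i b := by
  rw [hilbertFun]
  refine finsum_mem_eq_sum_of_inter_support_eq _ ?_
  ext b
  simp only [Set.mem_inter_iff, Set.mem_Iic, Function.mem_support, Finset.coe_Icc, Set.mem_Icc]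
  constructor
  · rintro ⟨h1, h2⟩
    refine ⟨⟨?_, h1⟩, h2⟩
    by_contra h
    exact h2 (hilbertFun_eq_zero h0 i b (by omega))
  · exact fun h => ⟨h.1.2, h.2⟩

theorem shiftDiff_hilbertFun_succ {𝒩 : ℤ → Submodule K N} {a₀ : ℤ} (h0 : ∀ a < a₀, 𝒩 a = ⊥)
    (i : ℕ) : shiftDiff 1 (fun a => (hilbertFun 𝒩 (i + 1) a : ℤ)) =
      fun a => (hilbertFun 𝒩 i a : ℤ) := by
  funext a
  rw [shiftDiff]
  by_cases ha : a < a₀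
  · rw [hilbertFun_eq_zero h0 _ a ha, hilbertFun_eq_zero h0 _ (a - 1) (by omega),
      hilbertFun_eq_zero h0 _ a ha]
    rfl
  · have : Finset.Icc a₀ a = insert a (Finset.Icc a₀ (a - 1)) := by
      ext b
      simp only [Finset.mem_Icc, Finset.mem_insert]
      omega
    rw [hilbertFun_succ_eq_sum h0, hilbertFun_succ_eq_sum h0, this, Finset.sum_insert (by simp)]
    push_cast
    ring

/-- Differencing undoes the iterated sums. Hence the numerator over (1-s)^{d+i} is the same for all
i. -/
theorem shiftDiff_iterate_hilbertFun {𝒩 : ℤ → Submodule K N} {a₀ : ℤ} (h0 : ∀ a < a₀, 𝒩 a = ⊥)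
    (i : ℕ) : (shiftDiff 1)^[i] (fun a => (hilbertFun 𝒩 i a : ℤ)) =
      fun a => (Module.finrank K (𝒩 a) : ℤ) := by
  induction i with
  | zero => rfl
  | succ i ih => rw [Function.iterate_succ_apply, shiftDiff_hilbertFun_succ h0, ih]

/-- The iterated Hilbert coefficients are the binomial moments of the numerator of the Hilbert
series. -/
theorem isHilbertCoeffs_of_finite_support (n : ℕ) [Module (SRing K n) N] {𝒩 : ℤ → Submodule K N}
    {a₀ : ℤ} (h0 : ∀ a < a₀, 𝒩 a = ⊥)
    (hfin : ((shiftDiff 1)^[natDim K n N] fun a => (Module.finrank K (𝒩 a) : ℤ)).support.Finite)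
    (i : ℕ) :
    IsHilbertCoeffs n 𝒩 i fun j => if j < natDim K n N + i then
      binomMoment ((shiftDiff 1)^[natDim K n N] fun a => (Module.finrank K (𝒩 a) : ℤ)) j else 0 := by
  refine ⟨?_, fun j hj => if_neg (by omega)⟩
  have e : (shiftDiff 1)^[natDim K n N + i] (fun a => (hilbertFun 𝒩 i a : ℤ)) =
      (shiftDiff 1)^[natDim K n N] fun a => (Module.finrank K (𝒩 a) : ℤ) := by
    rw [Function.iterate_add_apply, shiftDiff_iterate_hilbertFun h0]
  have := eventually_eq_eval_sum (f := fun a => (hilbertFun 𝒩 i a : ℤ)) (a₀ := a₀)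
    (fun a ha => by simp [hilbertFun_eq_zero h0 i a ha]) (natDim K n N + i) (by rwa [e])
  rw [e] at this
  filter_upwards [this] with a ha
  rw [Int.cast_natCast] at ha
  rw [ha]
  congr 1
  refine Finset.sum_congr rfl fun j hj => ?_
  rw [if_pos (Finset.mem_range.mp hj)]

theorem IsHilbertCoeffs.unique {n : ℕ} [Module (SRing K n) N] {𝒩 : ℤ → Submodule K N} {i : ℕ}
    {c c' : ℕ → ℤ} (h : IsHilbertCoeffs n 𝒩 i c) (h' : IsHilbertCoeffs n 𝒩 i c') : c = c' := by
  funext j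
  by_cases hj : j < natDim K n N + i
  · refine binomPoly_sum_injective (eq_of_eventually_eval_eq ?_) j hj
    filter_upwards [h.1, h'.1] with a h1 h2
    rw [← h1, h2]
  · rw [h.2 j (by omega), h'.2 j (by omega)]

/-- Uniqueness identifies the chosen coefficients with any explicit ones. -/
theorem IsHilbertCoeffs.hilbertCoeff_eq {n : ℕ} [Module (SRing K n) N] {𝒩 : ℤ → Submodule K N}
    {i : ℕ} {c : ℕ → ℤ} (h : IsHilbertCoeffs n 𝒩 i c) : hilbertCoeff n 𝒩 i = c := by
  funext j
  have hex : ∃ c : ℕ → ℤ, IsHilbertCoeffs n 𝒩 i c := ⟨c, h⟩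
  rw [hilbertCoeff, dif_pos hex]
  exact congrFun (hex.choose_spec.unique h) j

end HilbertFun

/-! ### Linear algebra of independent families. -/

theorem mem_of_mem_iSup_of_mem {K G M : Type*} [Field K] [AddCommGroup M] [Module K M]
    {W ℳ : G → Submodule K M} (hℳ : iSupIndep ℳ) (hW : W ≤ ℳ) {g : G} {x : M}
    (hx : x ∈ ⨆ h, W h) (hxg : x ∈ ℳ g) : x ∈ W g := by
  rw [iSup_split_single _ g] at hx
  obtain ⟨y, hy, z, hz, rfl⟩ := Submodule.mem_sup.mp hx
  have hz' : z ∈ ⨆ h, ⨆ (_ : h ≠ g), ℳ h :=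
    (iSup₂_mono fun h _ => hW h : (⨆ h, ⨆ (_ : h ≠ g), W h) ≤ _) hz
  have hzg : z ∈ ℳ g := by simpa using Submodule.sub_mem _ hxg (hW g hy)
  rw [Submodule.disjoint_def.mp (hℳ g) z hzg hz', add_zero]
  exact hy

/-- An element of `N g` lying in the sum of the `W h` has no component outside degree `g`, by
independence. So equality of families can be tested on their sums. -/
theorem eq_of_le_of_iSup_le {K G M : Type*} [Field K] [AddCommGroup M] [Module K M]
    {W N : G → Submodule K M} (hN : iSupIndep N) (hWN : W ≤ N)
    (h : (⨆ g, N g) ≤ ⨆ g, W g) : W = N := by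
  funext g
  exact le_antisymm (hWN g) fun x hx =>
    mem_of_mem_iSup_of_mem hN hWN (h (Submodule.mem_iSup_of_mem g hx)) hx

/-- Rank-nullity for the map `V × Q → M`, `(v, q) ↦ f v - q`. -/
theorem finrank_inf_comap_add_finrank_map_sup {K M : Type*} [Field K] [AddCommGroup M] [Module K M]
    (f : M →ₗ[K] M) (V Q : Submodule K M) [FiniteDimensional K V] [FiniteDimensional K Q] :
    Module.finrank K (V ⊓ Q.comap f : Submodule K M) +
      Module.finrank K (V.map f ⊔ Q : Submodule K M) =
      Module.finrank K V + Module.finrank K Q := by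
  let φ : (V × Q) →ₗ[K] M := (f.comp V.subtype).coprod Q.subtype
  have h1 : LinearMap.range φ = V.map f ⊔ Q := by
    rw [LinearMap.range_coprod, LinearMap.range_comp, Submodule.range_subtype,
      Submodule.range_subtype]
  have h2 : Module.finrank K (LinearMap.ker φ) =
      Module.finrank K (V ⊓ Q.comap f : Submodule K M) := by
    refine LinearEquiv.finrank_eq ?_
    refine LinearEquiv.ofBijective
      (LinearMap.codRestrict _ ((V.subtype.comp (LinearMap.fst K V Q)).comp
        (LinearMap.ker φ).subtype) ?_) ⟨?_, ?_⟩
    · rintro ⟨⟨v, q⟩, h⟩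
      refine ⟨v.2, ?_⟩
      have : f v + q = 0 := by simpa [φ] using h
      change f v ∈ Q
      rw [eq_neg_of_add_eq_zero_left this]
      exact Q.neg_mem q.2
    · rw [← LinearMap.ker_eq_bot, LinearMap.ker_eq_bot']
      rintro ⟨⟨v, q⟩, h⟩ h0
      have h3 : f v + q = 0 := by simpa [φ] using h
      have h4 : (v : M) = 0 := congrArg Subtype.val h0
      rw [h4, map_zero, zero_add] at h3
      ext
      · exact h4
      · exact h3
    · rintro ⟨v, hv, hq⟩
      refine ⟨⟨(⟨v, hv⟩, -⟨f v, hq⟩), ?_⟩, rfl⟩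
      simp [φ]
  rw [← h1, ← h2, add_comm, LinearMap.finrank_range_add_finrank_ker, Module.finrank_prod]

/-! ### The Hilbert–Serre theorem for modules graded by a group. -/

section GradedFamily

open MvPolynomial (X C)

variable {K : Type*} [Field K] {ι : Type*} {G : Type*} [AddCommGroup G] {M : Type*}
  [AddCommGroup M] [Module K M] [Module (MvPolynomial ι K) M] [IsScalarTower K (MvPolynomial ι K) M]

/-- A family of subspaces is stable if the variable `X i` maps the subspace of degree `g` to that of
degree `g + w i`. -/
def IsStable (w : ι → G) (N : G → Submodule K M) : Prop :=
  ∀ i g, ∀ x ∈ N g, (X i : MvPolynomial ι K) • x ∈ N (g + w i)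

variable (K M) in
/-- Multiplication by the variable `X i`. -/
noncomputable def mulX (i : ι) : M →ₗ[K] M := Algebra.lsmul K K M (X i : MvPolynomial ι K)

@[simp]
theorem mulX_apply (i : ι) (x : M) : mulX K M i x = (X i : MvPolynomial ι K) • x := rfl

variable {w : ι → G} {N P W ℳ : G → Submodule K M}

theorem IsStable.smul_mem_iSup (hN : IsStable w N) (f : MvPolynomial ι K) :
    ∀ x ∈ (⨆ g, N g), f • x ∈ (⨆ g, N g) := by
  induction f using MvPolynomial.induction_on with
  | C c =>
    intro x hx
    rw [← MvPolynomial.algebraMap_eq, algebraMap_smul]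
    exact Submodule.smul_mem _ c hx
  | add f g hf hg =>
    intro x hx
    rw [add_smul]
    exact Submodule.add_mem _ (hf x hx) (hg x hx)
  | mul_X f i hf =>
    intro x hx
    rw [mul_smul]
    refine hf _ ?_
    induction hx using Submodule.iSup_induction' with
    | mem g x hx => exact Submodule.mem_iSup_of_mem _ (hN i g x hx)
    | zero => simp
    | add x y _ _ hx hy =>
      rw [smul_add]
      exact Submodule.add_mem _ hx hy

/-- The sum of a stable family, as a submodule over the polynomial ring. -/
def IsStable.total (hN : IsStable w N) : Submodule (MvPolynomial ι K) M where
  carrier := (⨆ g, N g : Submodule K M)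
  add_mem' hx hy := Submodule.add_mem _ hx hy
  zero_mem' := Submodule.zero_mem _
  smul_mem' f x hx := hN.smul_mem_iSup f x hx

/-- The sum of the family is finitely generated by noetherianity, and each generator has only
finitely many components; their degrees form `T`. -/
theorem IsStable.exists_finset_degrees [Finite ι] [Module.Finite (MvPolynomial ι K) M]
    (hN : IsStable w N) (hind : iSupIndep N) :
    ∃ T : Finset G, ∀ W, IsStable w W → W ≤ N → (∀ g ∈ T, N g ≤ W g) → W = N := by
  classical
  have : IsNoetherian (MvPolynomial ι K) M := isNoetherian_of_isNoetherianRing_of_finite _ _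
  obtain ⟨s, hs⟩ := IsNoetherian.noetherian hN.total
  have hfin : ∀ x : M, ∃ T : Finset G, x ∈ (⨆ g, N g) → x ∈ ⨆ g ∈ T, N g := fun x => by
    by_cases hx : x ∈ ⨆ g, N g
    · obtain ⟨T, hT⟩ := (Submodule.mem_iSup_iff_exists_finset).mp hx
      exact ⟨T, fun _ => hT⟩
    · exact ⟨∅, fun h => absurd h hx⟩
  choose T hT using hfin
  refine ⟨s.biUnion T, fun W hW hWN h => eq_of_le_of_iSup_le hind hWN fun x hx => ?_⟩
  have hle : hN.total ≤ hW.total := by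
    rw [← hs, Submodule.span_le]
    intro y hy
    have hyN : y ∈ hN.total := hs ▸ Submodule.subset_span hy
    refine (iSup₂_le fun g hg => ?_ : (⨆ g ∈ T y, N g) ≤ ⨆ g, W g) (hT y hyN)
    exact (h g (Finset.mem_biUnion.mpr ⟨y, hy, hg⟩)).trans (le_iSup W g)
  exact hle hx

/-- The preimage in `N` of the kernel of `X i` on the subquotient N/P. -/
theorem IsStable.inf_comap (hN : IsStable w N) (hP : IsStable w P) (i : ι) :
    IsStable w fun g => N g ⊓ (P (g + w i)).comap (mulX K M i) := by
  intro j g x hx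
  refine ⟨hN j g x hx.1, ?_⟩
  have h := hP j _ _ hx.2
  rw [mulX_apply, smul_smul, mul_comm, ← smul_smul] at h
  rwa [add_right_comm] at h

/-- The submodule X_i N + P, whose quotient in N is the cokernel of `X i` on N/P when P ⊆ N. -/
theorem IsStable.map_sup (hN : IsStable w N) (hP : IsStable w P) (i : ι) :
    IsStable w fun g => (N (g - w i)).map (mulX K M i) ⊔ P g := by
  intro j g x hx
  obtain ⟨_, ⟨y, hy, rfl⟩, z, hz, rfl⟩ := Submodule.mem_sup.mp hx
  rw [smul_add]
  refine Submodule.add_mem_sup ⟨(X j : MvPolynomial ι K) • y, ?_, ?_⟩ (hP j g z hz)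
  · have h := hN j _ y hy
    rwa [sub_add_eq_add_sub] at h
  · rw [mulX_apply, mulX_apply, smul_smul, smul_smul, mul_comm]

/-- The Hilbert-Serre theorem for subquotients of a graded module on which all variables outside of
a list act as zero. -/
theorem finite_support_shiftDiffs_subquotient [Finite ι] [Module.Finite (MvPolynomial ι K) M]
    (hℳ : iSupIndep ℳ) [∀ g, FiniteDimensional K (ℳ g)] (l : List ι) {N P : G → Submodule K M}
    (hN : IsStable w N) (hP : IsStable w P) (hPN : P ≤ N) (hNℳ : N ≤ ℳ)
    (hl : ∀ i ∉ l, ∀ g, ∀ x ∈ N g, (X i : MvPolynomial ι K) • x ∈ P (g + w i)) :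
    (shiftDiffs (l.map w)
      fun g => (Module.finrank K (N g) : ℤ) - Module.finrank K (P g)).support.Finite := by
  classical
  induction l generalizing N P with
  | nil =>
    obtain ⟨T, hT⟩ := hN.exists_finset_degrees (hℳ.mono hNℳ)
    -- All variables kill N/P, so replacing `N` by `P` outside `T` leaves a stable family. It must
    -- equal `N`, whence N = P outside `T`.
    have hW := hT (fun g => if g ∈ T then N g else P g)
      (fun i g x hx => by
        have hx' : x ∈ N g := by
          dsimp only at hx
          split_ifs at hx
          exacts [hx, hPN g hx]
        have := hl i (by simp) g x hx'
        dsimp only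
        split_ifs
        exacts [hPN _ this, this])
      (fun g => by
        dsimp only
        split_ifs
        exacts [le_rfl, hPN g])
      (fun g hg => by simp [hg])
    refine T.finite_toSet.subset fun g hg => ?_
    by_contra hgT
    have h := congrFun hW g
    rw [Finset.mem_coe] at hgT
    simp only [hgT, if_false] at h
    exact hg (by rw [List.map_nil, shiftDiffs_nil, h, sub_self])
  | cons i l ih =>
    have hfd : ∀ (V : G → Submodule K M), V ≤ ℳ → ∀ g, FiniteDimensional K (V g) :=
      fun V hV g => Submodule.finiteDimensional_of_le (hV g)
    have hN' := hN.inf_comap hP i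
    have hP' := hN.map_sup hP i
    have hPN' : P ≤ fun g => N g ⊓ (P (g + w i)).comap (mulX K M i) :=
      fun g x hx => ⟨hPN g hx, hP i g x hx⟩
    have hP'N : (fun g => (N (g - w i)).map (mulX K M i) ⊔ P g) ≤ N := by
      intro g
      refine sup_le ?_ (hPN g)
      rintro _ ⟨x, hx, rfl⟩
      have := hN i _ x hx
      rwa [sub_add_cancel] at this
    have hN'N : (fun g => N g ⊓ (P (g + w i)).comap (mulX K M i)) ≤ N := fun g => inf_le_left
    have h1 := ih hN hP' hP'N hNℳ fun j hj g x hx => by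
      by_cases hji : j = i
      · subst hji
        refine Submodule.mem_sup_left ⟨x, ?_, rfl⟩
        simpa using hx
      · exact Submodule.mem_sup_right (hl j (by simp [hj, hji]) g x hx)
    have h2 := ih hN' hP hPN' (hN'N.trans hNℳ) fun j hj g x hx => by
      by_cases hji : j = i
      · subst hji
        exact hx.2
      · exact hl j (by simp [hj, hji]) g x hx.1
    -- The Euler characteristic of kernel → N/P → N/P → cokernel for `X i`. On both the kernel and
    -- the cokernel `X i` acts as zero, so the shorter list suffices there.
    have key : shiftDiff (w i) (fun g => (Module.finrank K (N g) : ℤ) - Module.finrank K (P g)) =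
        fun g => ((Module.finrank K (N g) : ℤ) -
            Module.finrank K ((N (g - w i)).map (mulX K M i) ⊔ P g : Submodule K M)) -
          ((Module.finrank K (N (g - w i) ⊓ (P (g - w i + w i)).comap (mulX K M i) :
            Submodule K M) : ℤ) - Module.finrank K (P (g - w i))) := by
      funext g
      have := hfd N hNℳ (g - w i)
      have := hfd P (hPN.trans hNℳ) g
      have h := finrank_inf_comap_add_finrank_map_sup (mulX K M i) (N (g - w i)) (P g)
      rw [sub_add_cancel, shiftDiff]
      have h' := congrArg (Nat.cast : ℕ → ℤ) h
      push_cast at h'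
      linarith
    rw [List.map_cons, shiftDiffs_cons, ← shiftDiffs_shiftDiff, key]
    rw [shiftDiffs_sub_translate (l.map w) (w i)
      (fun g => (Module.finrank K (N g) : ℤ) -
        Module.finrank K ((N (g - w i)).map (mulX K M i) ⊔ P g : Submodule K M))
      (fun g => (Module.finrank K (N g ⊓ (P (g + w i)).comap (mulX K M i) :
            Submodule K M) : ℤ) - Module.finrank K (P g))]
    refine (h1.union (h2.preimage (f := fun g => g - w i)
      sub_left_injective.injOn)).subset (Function.support_sub _ _)

/-- The Hilbert-Serre theorem for finitely generated graded modules over a polynomial ring graded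
by an abelian group. -/
theorem finite_support_shiftDiffs_finrank [Finite ι] [Module.Finite (MvPolynomial ι K) M]
    (hℳ : iSupIndep ℳ) [∀ g, FiniteDimensional K (ℳ g)] (hst : IsStable w ℳ) {l : List ι}
    (hl : ∀ i, i ∈ l) :
    (shiftDiffs (l.map w) fun g => (Module.finrank K (ℳ g) : ℤ)).support.Finite := by
  have := finite_support_shiftDiffs_subquotient hℳ l hst (P := fun _ => ⊥)
    (fun i g x hx => by
      rw [Submodule.mem_bot] at hx ⊢
      rw [hx, smul_zero]) (fun g => bot_le) le_rfl (fun i hi => absurd (hl i) hi)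
  simpa using this

/-- A finitely generated graded module has finitely many homogeneous generators. -/
theorem exists_homogeneous_generators [Module.Finite (MvPolynomial ι K) M]
    (htop : (⨆ g, ℳ g) = ⊤) :
    ∃ (t : Finset M) (deg : M → G), (∀ x ∈ t, x ∈ ℳ (deg x)) ∧
      Submodule.span (MvPolynomial ι K) (t : Set M) = ⊤ := by
  have h1 : Submodule.span (MvPolynomial ι K) (⋃ g, (ℳ g : Set M)) = ⊤ := by
    rw [eq_top_iff]
    rintro x -
    have hx : x ∈ ⨆ g, ℳ g := htop ▸ Submodule.mem_top
    rw [Submodule.iSup_eq_span] at hx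
    exact Submodule.span_subset_span K (MvPolynomial ι K) _ hx
  have h2 : (Submodule.span (MvPolynomial ι K) (⋃ g, (ℳ g : Set M))).FG := by
    rw [h1]
    exact Module.Finite.fg_top
  obtain ⟨t, ht, ht'⟩ := (Submodule.fg_span_iff_fg_span_finset_subset _).mp h2
  have h3 : ∀ x : M, ∃ g, x ∈ t → x ∈ ℳ g := fun x => by
    by_cases hx : x ∈ t
    · obtain ⟨g, hg⟩ := Set.mem_iUnion.mp (ht hx)
      exact ⟨g, fun _ => hg⟩
    · exact ⟨0, fun h => absurd h hx⟩
  choose deg hdeg using h3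
  exact ⟨t, deg, hdeg, ht' ▸ h1⟩

/-- The sum of a stable family is a submodule over the polynomial ring, so it is everything once it
contains the generators. This serves as the induction principle for graded components. -/
theorem IsStable.eq_of_generators (hℳ : iSupIndep ℳ) {t : Finset M} {deg : M → G}
    (ht : Submodule.span (MvPolynomial ι K) (t : Set M) = ⊤)
    (hW : IsStable w W) (hWℳ : W ≤ ℳ) (h : ∀ x ∈ t, x ∈ W (deg x)) : W = ℳ := by
  refine eq_of_le_of_iSup_le hℳ hWℳ fun x _ => ?_
  have : (⊤ : Submodule (MvPolynomial ι K) M) ≤ hW.total := by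
    rw [← ht, Submodule.span_le]
    exact fun y hy => Submodule.mem_iSup_of_mem _ (h y hy)
  exact this Submodule.mem_top

/-- Every component is spanned by generators of that degree and by multiples of the variables. -/
theorem IsStable.eq_span_sup_iSup_map (hℳ : iSupIndep ℳ) (hst : IsStable w ℳ) {t : Finset M}
    {deg : M → G} (hdeg : ∀ x ∈ t, x ∈ ℳ (deg x))
    (ht : Submodule.span (MvPolynomial ι K) (t : Set M) = ⊤) (g : G) :
    ℳ g = Submodule.span K {x | x ∈ t ∧ deg x = g} ⊔
      ⨆ i, (ℳ (g - w i)).map (mulX K M i) := by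
  have hle : (fun g => Submodule.span K {x | x ∈ t ∧ deg x = g} ⊔
      ⨆ i, (ℳ (g - w i)).map (mulX K M i)) ≤ ℳ := by
    intro g
    refine sup_le (Submodule.span_le.mpr ?_) (iSup_le fun i => ?_)
    · rintro x ⟨hx, rfl⟩
      exact hdeg x hx
    · rintro _ ⟨x, hx, rfl⟩
      have := hst i _ x hx
      rwa [sub_add_cancel] at this
  refine (congrFun (IsStable.eq_of_generators (w := w) (deg := deg) hℳ ht ?_ hle ?_) g).symm
  · intro i g x hx
    refine Submodule.mem_sup_right (Submodule.mem_iSup_of_mem i ⟨x, ?_, rfl⟩)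
    simpa using hle g hx
  · exact fun x hx => Submodule.mem_sup_left (Submodule.subset_span ⟨hx, rfl⟩)

end GradedFamily

/-! ### Finiteness and eventual dimension of the rows. -/

section Rows

variable {K : Type*} [Field K] {n m : ℕ} {p : Fin m → ℕ} {M : Type*} [AddCommGroup M] [Module K M]
  [Module (SRing K n) M] [Module (ARing K n m) M] [IsScalarTower K (SRing K n) M]
  [IsScalarTower (SRing K n) (ARing K n m) M] {ℳ : ℤ × ℤ → Submodule K M}

theorem isStable_of_gradedSMul {K : Type*} [Field K] {n m : ℕ} (p : Fin m → ℕ) {M : Type*}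
    [AddCommGroup M] [Module K M] [Module (ARing K n m) M] (ℳ : ℤ × ℤ → Submodule K M)
    [SetLike.GradedSMul (bigrading K n p) ℳ] : IsStable (bidegree n p) ℳ := by
  intro i g x hx
  have hX : (MvPolynomial.X i : ARing K n m) ∈ bigrading K n p (bidegree n p i) :=
    MvPolynomial.isWeightedHomogeneous_X K (bidegree n p) i
  have h := SetLike.GradedSMul.smul_mem (B := ℳ) hX hx
  rwa [vadd_eq_add, add_comm] at h

/-- All variables have nonnegative bidegree, so replacing by zero the components left of or below
every generator keeps the family stable. -/
theorem exists_lower_bounds {K : Type*} [Field K] {n m : ℕ} {p : Fin m → ℕ} {M : Type*}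
    [AddCommGroup M] [Module K M] [Module (ARing K n m) M] [IsScalarTower K (ARing K n m) M]
    {ℳ : ℤ × ℤ → Submodule K M} (hℳ : iSupIndep ℳ)
    (hst : IsStable (bidegree n p) ℳ) {t : Finset M} {deg : M → ℤ × ℤ}
    (hdeg : ∀ x ∈ t, x ∈ ℳ (deg x)) (ht : Submodule.span (ARing K n m) (t : Set M) = ⊤) :
    ∃ a₀ b₀ : ℤ, ∀ a b, a < a₀ ∨ b < b₀ → ℳ (a, b) = ⊥ := by
  classical
  obtain ⟨a₀, ha⟩ := (t.image fun x => (deg x).1).bddBelow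
  obtain ⟨b₀, hb⟩ := (t.image fun x => (deg x).2).bddBelow
  refine ⟨a₀, b₀, fun a b hab => ?_⟩
  have h := IsStable.eq_of_generators (w := bidegree n p) (deg := deg) hℳ ht
    (W := fun g => if g.1 < a₀ ∨ g.2 < b₀ then ⊥ else ℳ g) ?_ ?_ ?_
  · have := congrFun h (a, b)
    rw [← this]
    simp [hab]
  · intro i g x hx
    dsimp only at hx ⊢
    split_ifs at hx with h1
    · rw [Submodule.mem_bot] at hx
      rw [hx, smul_zero]
      exact Submodule.zero_mem _
    · rw [if_neg]
      · exact hst i g x hx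
      · rcases i with i | j
        · simp only [bidegree, Sum.elim_inl, Prod.fst_add, Prod.snd_add]
          omega
        · simp only [bidegree, Sum.elim_inr, Prod.fst_add, Prod.snd_add]
          omega
  · intro g
    dsimp only
    split_ifs
    exacts [bot_le, le_rfl]
  · intro x hx
    have h1 : a₀ ≤ (deg x).1 := ha (Finset.mem_coe.mpr (Finset.mem_image_of_mem _ hx))
    have h2 : b₀ ≤ (deg x).2 := hb (Finset.mem_coe.mpr (Finset.mem_image_of_mem _ hx))
    rw [if_neg (by omega)]
    exact hdeg x hx

/-- Each variable raises a + b by at least 1, so induction on a + b applies; for a + b < a₀ + b₀ the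
component is zero. -/
theorem finiteDimensional_component {K : Type*} [Field K] {n m : ℕ} {p : Fin m → ℕ} {M : Type*}
    [AddCommGroup M] [Module K M] [Module (ARing K n m) M] [IsScalarTower K (ARing K n m) M]
    {ℳ : ℤ × ℤ → Submodule K M} (hℳ : iSupIndep ℳ)
    (hst : IsStable (bidegree n p) ℳ) {t : Finset M} {deg : M → ℤ × ℤ}
    (hdeg : ∀ x ∈ t, x ∈ ℳ (deg x)) (ht : Submodule.span (ARing K n m) (t : Set M) = ⊤)
    (g : ℤ × ℤ) : FiniteDimensional K (ℳ g) := by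
  obtain ⟨a₀, b₀, h0⟩ := exists_lower_bounds hℳ hst hdeg ht
  have key : ∀ u : ℕ, ∀ g : ℤ × ℤ, g.1 + g.2 < a₀ + b₀ + u → FiniteDimensional K (ℳ g) := by
    intro u
    induction u with
    | zero =>
      intro g hg
      rw [h0 g.1 g.2 (by by_contra; omega)]
      infer_instance
    | succ u ih =>
      intro g hg
      rw [hst.eq_span_sup_iSup_map hℳ hdeg ht g]
      have h1 : FiniteDimensional K (Submodule.span K {x | x ∈ t ∧ deg x = g}) :=
        FiniteDimensional.span_of_finite K (t.finite_toSet.subset fun x hx => hx.1)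
      have h2 : ∀ i, FiniteDimensional K
          ((ℳ (g - bidegree n p i)).map (mulX K M i)) := fun i => by
        have : FiniteDimensional K (ℳ (g - bidegree n p i)) := by
          refine ih _ ?_
          rcases i with i | j
          · simp only [bidegree, Sum.elim_inl, Prod.fst_sub, Prod.snd_sub]
            omega
          · simp only [bidegree, Sum.elim_inr, Prod.fst_sub, Prod.snd_sub]
            omega
        infer_instance
      infer_instance
  exact key (g.1 + g.2 - a₀ - b₀ + 1).toNat g (by omega)

variable (K n M) in
/-- Multiplication by `y_j`, as an endomorphism of the `S`-module `M`. -/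
noncomputable def mulY (j : Fin m) : M →ₗ[SRing K n] M :=
  Algebra.lsmul (SRing K n) (SRing K n) M (MvPolynomial.X (Sum.inr j) : ARing K n m)

theorem X_smul_eq {K : Type*} [Field K] {n m : ℕ} {M : Type*} [AddCommGroup M]
    [Module (SRing K n) M] [Module (ARing K n m) M]
    [IsScalarTower (SRing K n) (ARing K n m) M] (i : Fin n) (x : M) :
    (MvPolynomial.X (Sum.inl i) : ARing K n m) • x = (MvPolynomial.X i : SRing K n) • x := by
  rw [← algebraMap_smul (ARing K n m) (MvPolynomial.X i : SRing K n) x]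
  congr 1
  exact (MvPolynomial.rename_X _ _).symm

variable [SetLike.GradedSMul (bigrading K n p) ℳ]

theorem mem_row {k : ℤ} {x : M} : x ∈ row n p ℳ k ↔ x ∈ ⨆ a, ℳ (a, k) := Iff.rfl

theorem component_le_row (a k : ℤ) : ∀ x ∈ ℳ (a, k), x ∈ row n p ℳ k :=
  fun _ hx => mem_row.mpr (Submodule.mem_iSup_of_mem a hx)

variable [IsScalarTower K (ARing K n m) M]

/-- A row is contained in any `S`-submodule that contains its generators and the products of the
variables `y_j` with the previous row. -/
theorem row_le_span_sup_iSup_map (hℳ : iSupIndep ℳ) {t : Finset M} {deg : M → ℤ × ℤ}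
    (hdeg : ∀ x ∈ t, x ∈ ℳ (deg x)) (ht : Submodule.span (ARing K n m) (t : Set M) = ⊤) (k : ℤ) :
    row n p ℳ k ≤ Submodule.span (SRing K n) {x | x ∈ t ∧ (deg x).2 = k} ⊔
      ⨆ j : Fin m, (row n p ℳ (k - 1)).map (mulY K n M j) := by
  have hst := isStable_of_gradedSMul (n := n) p ℳ
  obtain ⟨a₀, b₀, h0⟩ := exists_lower_bounds hℳ hst hdeg ht
  set R := Submodule.span (SRing K n) {x | x ∈ t ∧ (deg x).2 = k} ⊔
      ⨆ j : Fin m, (row n p ℳ (k - 1)).map (mulY K n M j) with hR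
  have key : ∀ a, a₀ - 1 ≤ a → ℳ (a, k) ≤ R.restrictScalars K := by
    intro a ha
    induction a, ha using Int.leInduction with
    | base =>
      rw [h0 _ _ (Or.inl (by omega))]
      exact bot_le
    | succ a ha ih =>
      rw [hst.eq_span_sup_iSup_map hℳ hdeg ht]
      refine sup_le (Submodule.span_le.mpr ?_) (iSup_le fun i => ?_)
      · rintro x ⟨hx, hx'⟩
        exact Submodule.mem_sup_left (Submodule.subset_span ⟨hx, by rw [hx']⟩)
      · rintro _ ⟨x, hx, rfl⟩
        rcases i with i | j
        · rw [mulX_apply, X_smul_eq]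
          have hx' : x ∈ ℳ (a, k) := by simpa [bidegree] using hx
          exact R.smul_mem _ (ih hx')
        · refine Submodule.mem_sup_right (Submodule.mem_iSup_of_mem j ⟨x, ?_, rfl⟩)
          have hx' : x ∈ ℳ (a + 1 - p j, k - 1) := by simpa [bidegree] using hx
          exact component_le_row _ _ x hx'
  intro x hx
  refine (iSup_le fun a => ?_ : (⨆ a, ℳ (a, k)) ≤ R.restrictScalars K) hx
  by_cases ha : a < a₀
  · rw [h0 _ _ (Or.inl ha)]
    exact bot_le
  · exact key a (by omega)

/-- Upward induction from the zero rows: each row lies in a finitely generated S-module built from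
the previous row, and S is noetherian. -/
theorem row_fg (hℳ : iSupIndep ℳ) {t : Finset M} {deg : M → ℤ × ℤ}
    (hdeg : ∀ x ∈ t, x ∈ ℳ (deg x)) (ht : Submodule.span (ARing K n m) (t : Set M) = ⊤) (k : ℤ) :
    (row n p ℳ k).FG := by
  have hst := isStable_of_gradedSMul (n := n) p ℳ
  obtain ⟨a₀, b₀, h0⟩ := exists_lower_bounds hℳ hst hdeg ht
  have hbot : ∀ k < b₀, row n p ℳ k = ⊥ := fun k hk => by
    rw [eq_bot_iff]
    intro x hx
    rw [mem_row] at hx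
    simpa [fun a => h0 a k (Or.inr hk)] using hx
  have key : ∀ k, b₀ - 1 ≤ k → (row n p ℳ k).FG := by
    intro k hk
    induction k, hk using Int.leInduction with
    | base =>
      rw [hbot _ (by omega)]
      exact Submodule.fg_bot
    | succ k hk ih =>
      have h1 : (Submodule.span (SRing K n) {x | x ∈ t ∧ (deg x).2 = k + 1}).FG :=
        Submodule.fg_span (t.finite_toSet.subset fun x hx => hx.1)
      have h2 : (⨆ j : Fin m, (row n p ℳ (k + 1 - 1)).map (mulY K n M j)).FG := by
        refine Submodule.fg_iSup _ fun j => ?_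
        rw [add_sub_cancel_right]
        exact ih.map _
      have h3 := isNoetherian_of_fg_of_noetherian _ (h1.sup h2)
      exact isNoetherian_submodule.mp h3 _ (row_le_span_sup_iSup_map hℳ hdeg ht (k + 1))
  by_cases hk : k < b₀
  · rw [hbot k hk]
    exact Submodule.fg_bot
  · exact key k (by omega)

/-- The Krull dimension of the rows is eventually constant. -/
theorem exists_supportDim_row_eq (hℳ : iSupIndep ℳ) {t : Finset M} {deg : M → ℤ × ℤ}
    (hdeg : ∀ x ∈ t, x ∈ ℳ (deg x)) (ht : Submodule.span (ARing K n m) (t : Set M) = ⊤) :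
    ∃ (k₀ : ℤ) (δ : WithBot ℕ∞), ∀ k ≥ k₀,
      Module.supportDim (SRing K n) (row n p ℳ k) = δ := by
  classical
  obtain ⟨b₁, hb⟩ := (t.image fun x => (deg x).2).bddAbove
  -- Above all generator degrees the row is spanned by the products of the `y_j` with the previous
  -- row, and multiplication by `y_j` commutes with S.
  have hmono : ∀ k > b₁, (row n p ℳ (k - 1)).annihilator ≤ (row n p ℳ k).annihilator := by
    intro k hk s hs
    have hle := row_le_span_sup_iSup_map (p := p) hℳ hdeg ht k
    have hempty : {x | x ∈ t ∧ (deg x).2 = k} = ∅ := by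
      refine Set.eq_empty_iff_forall_notMem.mpr fun x hx => ?_
      have : (deg x).2 ≤ b₁ := hb (Finset.mem_coe.mpr (Finset.mem_image_of_mem _ hx.1))
      rw [hx.2] at this
      omega
    rw [hempty, Submodule.span_empty, bot_sup_eq] at hle
    rw [Submodule.mem_annihilator] at hs ⊢
    intro x hx
    have hker : (⨆ j : Fin m, (row n p ℳ (k - 1)).map (mulY K n M j)) ≤
        LinearMap.ker (LinearMap.lsmul (SRing K n) M s) := by
      refine iSup_le fun j => ?_
      rintro _ ⟨y, hy, rfl⟩
      rw [LinearMap.mem_ker, LinearMap.lsmul_apply, ← map_smul, hs y hy, map_zero]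
    exact hker (hle hx)
  let f : ℕ →o Ideal (SRing K n) := ⟨fun u => (row n p ℳ (b₁ + u)).annihilator,
    monotone_nat_of_le_succ fun u => by
      have := hmono (b₁ + (u + 1 : ℕ)) (by push_cast; omega)
      rwa [show b₁ + ((u + 1 : ℕ) : ℤ) - 1 = b₁ + u by push_cast; ring] at this⟩
  obtain ⟨N, hN⟩ := monotone_stabilizes_iff_noetherian.mpr
    (inferInstance : IsNoetherian (SRing K n) (SRing K n)) f
  refine ⟨b₁ + N, ringKrullDim (SRing K n ⧸ f N), fun k hk => ?_⟩
  have : Module.Finite (SRing K n) (row n p ℳ k) :=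
    Module.Finite.iff_fg.mpr (row_fg hℳ hdeg ht k)
  rw [Module.supportDim_eq_ringKrullDim_quotient_annihilator,
    hN (k - b₁).toNat (by omega)]
  have e : b₁ + (((k - b₁).toNat : ℕ) : ℤ) = k := by omega
  change _ = ringKrullDim (SRing K n ⧸ (row n p ℳ (b₁ + (((k - b₁).toNat : ℕ) : ℤ))).annihilator)
  rw [e]

end Rows

/-! ### Noether normalization of modules. -/

section Normalization

/-- Lying over lifts the first prime of a chain, and going up lifts the rest. -/
theorem ringKrullDim_le_of_isIntegral {R B : Type*} [CommRing R] [CommRing B] {f : R →+* B}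
    (hf : f.IsIntegral) (hinj : Function.Injective f) : ringKrullDim R ≤ ringKrullDim B := by
  algebraize [f]
  refine iSup_le fun l => ?_
  obtain ⟨P, hP⟩ := hf.comap_surjective hinj l.head
  have : P.asIdeal.LiesOver l.head.asIdeal := ⟨by rw [← hP]; rfl⟩
  obtain ⟨L, hL, -⟩ := Ideal.exists_ltSeries_of_hasGoingUp l P.asIdeal
  rw [← hL]
  exact le_iSup (fun p : LTSeries (PrimeSpectrum B) => (p.length : WithBot ℕ∞)) L

/-- If `S ⧸ ann N` is finite over `R`, then so is the finitely generated `S`-module `N`. -/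
theorem exists_combination_of_finite {R S N : Type*} [CommRing R] [CommRing S] [AddCommGroup N]
    [Module S N] [Module.Finite S N] (φ : R →+* S)
    (hφ : ((Ideal.Quotient.mk (Module.annihilator S N)).comp φ).Finite) :
    ∃ E : Finset N, ∀ x : N, ∃ f : E → R, ∑ e, φ (f e) • (e : N) = x := by
  let I := Module.annihilator S N
  let _ : Algebra R (S ⧸ I) := ((Ideal.Quotient.mk I).comp φ).toAlgebra
  have hB : Module.Finite R (S ⧸ I) := hφ
  let _ : Module (S ⧸ I) N := Module.quotientAnnihilator
  let _ : Module R N := Module.compHom N φ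
  have hmk : ∀ (s : S) (x : N), (Ideal.Quotient.mk I s) • x = s • x := fun s x => rfl
  have : IsScalarTower R (S ⧸ I) N := ⟨fun f b x => by
    obtain ⟨s, rfl⟩ := Ideal.Quotient.mk_surjective b
    have h1 : f • (Ideal.Quotient.mk I s) = Ideal.Quotient.mk I (φ f * s) := by
      rw [map_mul]
      rfl
    rw [h1, hmk, hmk, mul_smul]
    rfl⟩
  have : IsScalarTower S (S ⧸ I) N := ⟨fun f b x => by
    obtain ⟨s, rfl⟩ := Ideal.Quotient.mk_surjective b
    have h1 : f • (Ideal.Quotient.mk I s) = Ideal.Quotient.mk I (f * s) := rfl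
    rw [h1, hmk, hmk, mul_smul]⟩
  have : Module.Finite (S ⧸ I) N := Module.Finite.of_restrictScalars_finite S _ _
  have : Module.Finite R N := Module.Finite.trans (S ⧸ I) N
  obtain ⟨E, hE⟩ := (Module.finite_def.mp this : (⊤ : Submodule R N).FG)
  refine ⟨E, fun x => ?_⟩
  have hx : x ∈ Submodule.span R (E : Set N) := hE ▸ Submodule.mem_top
  obtain ⟨f, -, hf⟩ := Submodule.mem_span_finset.mp hx
  refine ⟨fun e => f e, ?_⟩
  rw [← hf, ← Finset.sum_coe_sort E]
  rfl

variable {K : Type*} [Field K] {n : ℕ} {N : Type*} [AddCommGroup N] [Module (SRing K n) N]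

/-- The dimension is at most n and not ⊥, so conversion to a natural number loses nothing. -/
theorem supportDim_eq_natDim [Nontrivial N] :
    Module.supportDim (SRing K n) N = (natDim K n N : WithBot ℕ∞) := by
  have h1 : Module.supportDim (SRing K n) N ≤ (n : WithBot ℕ∞) := by
    refine (Module.supportDim_le_ringKrullDim _ _).trans ?_
    rw [MvPolynomial.ringKrullDim_of_isNoetherianRing, ringKrullDim_eq_zero_of_field]
    simp
  have h2 := Module.supportDim_ne_bot_of_nontrivial (SRing K n) N
  rw [natDim]
  generalize Module.supportDim (SRing K n) N = δ at h1 h2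
  induction δ with
  | bot => exact absurd rfl h2
  | coe δ =>
    induction δ with
    | top => exact absurd (top_le_iff.mp (WithBot.coe_le_coe.mp h1)) (ENat.natCast_ne_top n)
    | coe d => simp

/-- Noether normalization for modules: a finitely generated `S`-module of Krull dimension `d` is
finitely generated over a polynomial ring in at most `d` variables. -/
theorem exists_finite_over_mvPolynomial [Module.Finite (SRing K n) N] :
    ∃ r ≤ natDim K n N, ∃ φ : MvPolynomial (Fin r) K →ₐ[K] SRing K n, ∃ E : Finset N,
      ∀ x : N, ∃ f : E → MvPolynomial (Fin r) K, ∑ e, φ (f e) • (e : N) = x := by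
  rcases subsingleton_or_nontrivial N with hN | hN
  · exact ⟨0, Nat.zero_le _, MvPolynomial.aeval fun _ => 0, ∅,
      fun x => ⟨fun _ => 0, Subsingleton.elim _ _⟩⟩
  let I := Module.annihilator (SRing K n) N
  have hI : Nontrivial (SRing K n ⧸ I) := by
    refine Ideal.Quotient.nontrivial_iff.mpr fun h => ?_
    obtain ⟨x, hx⟩ := exists_ne (0 : N)
    have h1 : (1 : SRing K n) ∈ I := h ▸ Submodule.mem_top
    exact hx (by simpa using Module.mem_annihilator.mp h1 x)
  obtain ⟨r, g, hinj, hfin⟩ := exists_finite_inj_algHom_of_fg K (SRing K n ⧸ I)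
  have hlift : ∀ b : SRing K n ⧸ I, ∃ s, Ideal.Quotient.mkₐ K I s = b :=
    Ideal.Quotient.mkₐ_surjective K I
  choose lift hl using hlift
  -- The normalization of S/ann N is lifted to S, so that its polynomials act on N through S. The
  -- lift is not required to respect degrees.
  let φ : MvPolynomial (Fin r) K →ₐ[K] SRing K n :=
    MvPolynomial.aeval fun i => lift (g (MvPolynomial.X i))
  have hφ : ∀ f, Ideal.Quotient.mkₐ K I (φ f) = g f := by
    intro f
    rw [← AlgHom.comp_apply]
    congr 1
    refine MvPolynomial.algHom_ext fun i => ?_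
    rw [AlgHom.comp_apply, MvPolynomial.aeval_X, hl]
  have hcomp : (Ideal.Quotient.mk I).comp φ.toRingHom = g.toRingHom := RingHom.ext hφ
  refine ⟨r, ?_, φ, exists_combination_of_finite φ.toRingHom (hcomp ▸ hfin)⟩
  have h := ringKrullDim_le_of_isIntegral (f := g.toRingHom) (RingHom.Finite.to_isIntegral hfin)
    hinj
  rw [MvPolynomial.ringKrullDim_of_isNoetherianRing, ringKrullDim_eq_zero_of_field,
    ← Module.supportDim_eq_ringKrullDim_quotient_annihilator, supportDim_eq_natDim] at h
  simpa using h

end Normalization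

/-! ### Growth of Hilbert functions and the dimension bound. -/

section Growth

theorem sum_finrank_le_of_iSupIndep {K κ N : Type*} [Field K] [AddCommGroup N]
    [Module K N] {𝒩 : κ → Submodule K N} (hind : iSupIndep 𝒩) (V : Submodule K N)
    [FiniteDimensional K V] (T : Finset κ) (hT : ∀ b ∈ T, 𝒩 b ≤ V) :
    ∑ b ∈ T, Module.finrank K (𝒩 b) ≤ Module.finrank K V := by
  classical
  have key : ∑ b ∈ T, Module.finrank K (𝒩 b) =
      Module.finrank K (⨆ b ∈ T, 𝒩 b : Submodule K N) := by
    induction T using Finset.induction_on with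
    | empty =>
      rw [Finset.sum_empty, show (⨆ b ∈ (∅ : Finset κ), 𝒩 b) = ⊥ by simp, finrank_bot]
    | insert b T hb ih =>
      rw [Finset.sum_insert hb, ih fun c hc => hT c (Finset.mem_insert_of_mem hc),
        Finset.iSup_insert]
      have h1 : FiniteDimensional K (𝒩 b) :=
        Submodule.finiteDimensional_of_le (hT b (Finset.mem_insert_self b T))
      have h2 : FiniteDimensional K (⨆ c ∈ T, 𝒩 c : Submodule K N) :=
        Submodule.finiteDimensional_of_le
          (iSup₂_le fun c hc => hT c (Finset.mem_insert_of_mem hc) : _ ≤ V)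
      have hdis : Disjoint (𝒩 b) (⨆ c ∈ T, 𝒩 c) :=
        hind.disjoint_biSup (x := b) (y := (T : Set κ)) (by simpa using hb)
      rw [← Submodule.finrank_sup_add_finrank_inf_eq, hdis.eq_bot, finrank_bot, add_zero]
  rw [key]
  exact Submodule.finrank_mono (iSup₂_le hT)

/-- The exponent vectors inject into (c+1)^r; bounding each variable separately makes the count
immediate. -/
theorem finrank_restrictDegree_le (K : Type*) [Field K] (r c : ℕ) :
    Module.finrank K (MvPolynomial.restrictDegree (Fin r) K c) ≤ (c + 1) ^ r := by
  rw [MvPolynomial.restrictDegree,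
    Module.finrank_eq_nat_card_basis (MvPolynomial.basisRestrictSupport K _)]
  let f : {s : Fin r →₀ ℕ | ∀ i, s i ≤ c} → Fin r → Fin (c + 1) :=
    fun s i => ⟨s.1 i, Nat.lt_succ_of_le (s.2 i)⟩
  have hf : Function.Injective f := fun s t h => by
    ext i
    exact congrArg Fin.val (congrFun h i)
  refine (Nat.card_le_card_of_injective f hf).trans ?_
  simp

theorem mul_mem_restrictDegree {K σ : Type*} [Field K] {f g : MvPolynomial σ K} {c d : ℕ}
    (hf : f ∈ MvPolynomial.restrictDegree σ K c) (hg : g ∈ MvPolynomial.restrictDegree σ K d) :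
    f * g ∈ MvPolynomial.restrictDegree σ K (c + d) := by
  classical
  rw [MvPolynomial.mem_restrictDegree] at hf hg ⊢
  intro s hs i
  obtain ⟨t, ht, u, hu, rfl⟩ := Finset.mem_add.mp (MvPolynomial.support_mul f g hs)
  exact add_le_add (hf t ht i) (hg u hu i)

theorem restrictDegree_mono {K σ : Type*} [Field K] {c d : ℕ} (h : c ≤ d) :
    MvPolynomial.restrictDegree σ K c ≤ MvPolynomial.restrictDegree σ K d :=
  fun f hf => by
    rw [MvPolynomial.mem_restrictDegree] at hf ⊢
    exact fun s hs i => (hf s hs i).trans h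

theorem exists_mem_restrictDegree {K σ κ : Type*} [Field K] [Finite κ]
    (f : κ → MvPolynomial σ K) : ∃ c, ∀ k, f k ∈ MvPolynomial.restrictDegree σ K c := by
  have := Fintype.ofFinite κ
  refine ⟨Finset.univ.sup fun k => (f k).totalDegree, fun k => ?_⟩
  refine MvPolynomial.restrictTotalDegree_le_restrictDegree σ K _ ?_
  rw [MvPolynomial.mem_restrictTotalDegree]
  exact Finset.le_sup (f := fun k => (f k).totalDegree) (Finset.mem_univ k)

variable {K : Type*} [Field K] {n : ℕ} {N : Type*} [AddCommGroup N] [Module K N]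
  [Module (SRing K n) N] [IsScalarTower K (SRing K n) N]

/-- The linear map sending a family of polynomials to the corresponding combination. -/
noncomputable def combination {r : ℕ} (φ : MvPolynomial (Fin r) K →ₐ[K] SRing K n) (E : Finset N) :
    (E → MvPolynomial (Fin r) K) →ₗ[K] N :=
  ∑ e : E, ((LinearMap.toSpanSingleton (SRing K n) N e).restrictScalars K ∘ₗ φ.toLinearMap) ∘ₗ
    LinearMap.proj e

theorem combination_apply {r : ℕ} (φ : MvPolynomial (Fin r) K →ₐ[K] SRing K n) (E : Finset N)
    (f : E → MvPolynomial (Fin r) K) : combination φ E f = ∑ e, φ (f e) • (e : N) := by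
  simp [combination]

/-- The combinations whose coefficients have degree at most `c` in each variable. -/
noncomputable def boundedCombinations {r : ℕ} (φ : MvPolynomial (Fin r) K →ₐ[K] SRing K n)
    (E : Finset N) (c : ℕ) : Submodule K N :=
  LinearMap.range (combination φ E ∘ₗ
    LinearMap.pi fun e => (MvPolynomial.restrictDegree (Fin r) K c).subtype ∘ₗ LinearMap.proj e)

theorem mem_boundedCombinations {r : ℕ} {φ : MvPolynomial (Fin r) K →ₐ[K] SRing K n}
    {E : Finset N} {c : ℕ} {x : N} : x ∈ boundedCombinations φ E c ↔
      ∃ f : E → MvPolynomial (Fin r) K, (∀ e, f e ∈ MvPolynomial.restrictDegree (Fin r) K c) ∧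
        ∑ e, φ (f e) • (e : N) = x := by
  constructor
  · rintro ⟨f, rfl⟩
    exact ⟨fun e => f e, fun e => (f e).2, (combination_apply φ E _).symm⟩
  · rintro ⟨f, hf, rfl⟩
    exact ⟨fun e => ⟨f e, hf e⟩, combination_apply φ E f⟩

instance {r : ℕ} (φ : MvPolynomial (Fin r) K →ₐ[K] SRing K n) (E : Finset N) (c : ℕ) :
    FiniteDimensional K (boundedCombinations φ E c) := by
  unfold boundedCombinations
  infer_instance

theorem finrank_boundedCombinations_le {r : ℕ} (φ : MvPolynomial (Fin r) K →ₐ[K] SRing K n)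
    (E : Finset N) (c : ℕ) :
    Module.finrank K (boundedCombinations φ E c) ≤ E.card * (c + 1) ^ r := by
  refine (LinearMap.finrank_range_le _).trans ?_
  rw [Module.finrank_pi_fintype, Finset.sum_const, Finset.card_univ, Fintype.card_coe, smul_eq_mul]
  exact Nat.mul_le_mul_left _ (finrank_restrictDegree_le K r c)

/-- The dimensions of the truncations of a finitely generated graded `S`-module of Krull dimension
`d` are bounded by a polynomial of degree `d`. -/
theorem exists_polynomial_bound [Module.Finite (SRing K n) N] {𝒩 : ℤ → Submodule K N}
    (hind : iSupIndep 𝒩) (hst : IsStable (fun _ : Fin n => (1 : ℤ)) 𝒩) {t : Finset N} {deg : N → ℤ}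
    (hdeg : ∀ x ∈ t, x ∈ 𝒩 (deg x)) (ht : Submodule.span (SRing K n) (t : Set N) = ⊤)
    {a₀ : ℤ} (h0 : ∀ a < a₀, 𝒩 a = ⊥) :
    ∃ W : ℚ[X], W ≠ 0 ∧ W.degree ≤ natDim K n N ∧ ∀ a ≥ a₀,
      ((∑ b ∈ Finset.Icc a₀ a, Module.finrank K (𝒩 b) : ℕ) : ℚ) ≤ W.eval (a : ℚ) := by
  obtain ⟨r, hr, φ, E, hE⟩ := exists_finite_over_mvPolynomial (K := K) (n := n) (N := N)
  have hVmono : ∀ {c d : ℕ}, c ≤ d → boundedCombinations φ E c ≤ boundedCombinations φ E d := by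
    intro c d hcd x hx
    obtain ⟨f, hf, rfl⟩ := mem_boundedCombinations.mp hx
    exact mem_boundedCombinations.mpr ⟨f, fun e => restrictDegree_mono hcd (hf e), rfl⟩
  choose coord hcoord using hE
  -- `c₀` bounds the coefficients of the homogeneous generators, and `D` below those of each
  -- variable times each element of `E`. Multiplying by a variable thus raises the degree bound by
  -- at most `D`, so it grows linearly with a.
  obtain ⟨c₀, hc₀⟩ := exists_mem_restrictDegree fun x : t × E => coord x.1 x.2
  obtain ⟨D, hD⟩ := exists_mem_restrictDegree fun x : (Fin n × E) × E =>
    coord ((MvPolynomial.X x.1.1 : SRing K n) • (x.1.2 : N)) x.2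
  have hVX : ∀ (i : Fin n) (c : ℕ), ∀ x ∈ boundedCombinations φ E c,
      (MvPolynomial.X i : SRing K n) • x ∈ boundedCombinations φ E (c + D) := by
    intro i c x hx
    obtain ⟨f, hf, rfl⟩ := mem_boundedCombinations.mp hx
    refine mem_boundedCombinations.mpr ⟨fun e' => ∑ e : E,
      f e * coord ((MvPolynomial.X i : SRing K n) • (e : N)) e', fun e' =>
      Submodule.sum_mem _ fun e _ => mul_mem_restrictDegree (hf e) (hD ((i, e), e')), ?_⟩
    simp only [map_sum, Finset.sum_smul, map_mul, mul_smul]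
    rw [Finset.sum_comm, Finset.smul_sum]
    refine Finset.sum_congr rfl fun e _ => ?_
    rw [← Finset.smul_sum, hcoord, smul_comm]
  let c : ℤ → ℕ := fun a => c₀ + D * (a - a₀ + 1).toNat
  have hle : ∀ a, a₀ - 1 ≤ a → 𝒩 a ≤ boundedCombinations φ E (c a) := by
    intro a ha
    induction a, ha using Int.leInduction with
    | base =>
      rw [h0 _ (by omega)]
      exact bot_le
    | succ a ha ih =>
      rw [hst.eq_span_sup_iSup_map hind hdeg ht]
      refine sup_le (Submodule.span_le.mpr ?_) (iSup_le fun i => ?_)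
      · rintro x ⟨hx, -⟩
        refine hVmono (Nat.le_add_right c₀ _) ?_
        exact mem_boundedCombinations.mpr ⟨coord x, fun e => hc₀ (⟨x, hx⟩, e), hcoord x⟩
      · rintro _ ⟨x, hx, rfl⟩
        rw [add_sub_cancel_right] at hx
        have hc : c (a + 1) = c a + D := by
          simp only [c]
          rw [show (a + 1 - a₀ + 1).toNat = (a - a₀ + 1).toNat + 1 by omega]
          ring
        rw [hc]
        exact hVX i _ x (ih hx)
  have hcmono : Monotone c := fun a b hab =>
    Nat.add_le_add_left (Nat.mul_le_mul_left D (by omega)) c₀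
  -- This is (|E| + 1)(c(a) + 1)^r written as a polynomial in a; the extra 1 keeps it nonzero when
  -- `E` is empty.
  let W : ℚ[X] := C ((E.card : ℚ) + 1) * (C (D : ℚ) * X + C ((c₀ : ℚ) + D * (1 - a₀) + 1)) ^ r
  have hW : ∀ a ≥ a₀, W.eval (a : ℚ) = ((E.card : ℚ) + 1) * ((c a : ℚ) + 1) ^ r := by
    intro a ha
    have : (((a - a₀ + 1).toNat : ℕ) : ℚ) = (a : ℚ) - a₀ + 1 := by
      have h : (((a - a₀ + 1).toNat : ℕ) : ℤ) = a - a₀ + 1 := by omega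
      exact_mod_cast congrArg (Int.cast : ℤ → ℚ) h
    simp only [W, eval_mul, eval_C, eval_pow, eval_add, eval_X, c]
    push_cast
    rw [this]
    ring
  refine ⟨W, ?_, ?_, fun a ha => ?_⟩
  · intro h
    have h1 := hW a₀ le_rfl
    rw [h, eval_zero] at h1
    have : (0 : ℚ) < ((E.card : ℚ) + 1) * ((c a₀ : ℚ) + 1) ^ r := by positivity
    linarith
  · refine degree_le_natDegree.trans ?_
    have h1 : (C (D : ℚ) * X + C ((c₀ : ℚ) + D * (1 - a₀) + 1)).natDegree ≤ 1 :=
      natDegree_linear_le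
    have h2 : W.natDegree ≤ r := by
      refine (natDegree_C_mul_le _ _).trans (natDegree_pow_le.trans ?_)
      simpa using Nat.mul_le_mul_left r h1
    exact_mod_cast h2.trans hr
  · have h1 := sum_finrank_le_of_iSupIndep hind (boundedCombinations φ E (c a)) (Finset.Icc a₀ a)
      fun b hb => by
        rw [Finset.mem_Icc] at hb
        exact (hle b (by omega)).trans (hVmono (hcmono hb.2))
    have h2 := h1.trans (finrank_boundedCombinations_le φ E (c a))
    rw [hW a ha]
    calc ((∑ b ∈ Finset.Icc a₀ a, Module.finrank K (𝒩 b) : ℕ) : ℚ)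
        ≤ ((E.card * (c a + 1) ^ r : ℕ) : ℚ) := by exact_mod_cast h2
      _ ≤ ((E.card : ℚ) + 1) * ((c a : ℚ) + 1) ^ r := by
        push_cast
        gcongr
        linarith

/-- The numerator of the Hilbert series: if `N` is a finitely generated graded `S`-module of Krull
dimension `d`, then `(1 - s) ^ d` times its Hilbert series is a Laurent polynomial. -/
theorem finite_support_shiftDiff_iterate_natDim [Module.Finite (SRing K n) N]
    {𝒩 : ℤ → Submodule K N} (hind : iSupIndep 𝒩) (htop : (⨆ a, 𝒩 a) = ⊤)
    [∀ a, FiniteDimensional K (𝒩 a)] (hst : IsStable (fun _ : Fin n => (1 : ℤ)) 𝒩)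
    {a₀ : ℤ} (h0 : ∀ a < a₀, 𝒩 a = ⊥) :
    ((shiftDiff 1)^[natDim K n N] fun a => (Module.finrank K (𝒩 a) : ℤ)).support.Finite := by
  obtain ⟨t, deg, hdeg, ht⟩ := exists_homogeneous_generators (K := K) (ι := Fin n) htop
  obtain ⟨W, hW0, hWd, hW⟩ := exists_polynomial_bound hind hst hdeg ht h0
  set h : ℤ → ℤ := fun a => (Module.finrank K (𝒩 a) : ℤ) with hh
  -- The summed Hilbert function is the quantity that the growth bound controls. Its degree is at
  -- most d, so its difference of order d + 1, which is the d-th difference of `h`, eventually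
  -- vanishes.
  let H : ℤ → ℤ := fun a => (hilbertFun 𝒩 1 a : ℤ)
  have hH : ∀ u, (shiftDiff 1)^[u + 1] H = (shiftDiff 1)^[u] h := fun u => by
    rw [Function.iterate_add_apply, shiftDiff_iterate_hilbertFun h0]
  have hserre := finite_support_shiftDiffs_finrank hind hst (l := List.finRange n) (by simp)
  have hrep : ∀ (l : List (Fin n)), shiftDiffs (l.map fun _ => (1 : ℤ)) h =
      (shiftDiff 1)^[l.length] h := fun l => by
    induction l with
    | nil => rfl
    | cons i l ih =>
      rw [List.map_cons, shiftDiffs_cons, ih, List.length_cons, Function.iterate_succ_apply']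
  rw [hrep, List.length_finRange, ← hH] at hserre
  obtain ⟨hi, hhi⟩ := hserre.bddAbove
  obtain ⟨P, hP⟩ := exists_polynomial_of_shiftDiff_iterate (f := H) (r := n + 1) (by
    filter_upwards [Filter.eventually_gt_atTop hi] with a ha
    by_contra hne
    exact absurd (hhi hne) (not_le.mpr ha))
  have hPd : P.degree ≤ W.degree := by
    refine degree_le_of_abs_le hW0 ?_
    filter_upwards [hP, Filter.eventually_ge_atTop a₀] with a h1 h2
    have h3 : (H a : ℚ) =
        ((∑ b ∈ Finset.Icc a₀ a, Module.finrank K (𝒩 b) : ℕ) : ℚ) := by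
      simp only [H]
      rw [hilbertFun_succ_eq_sum h0, Int.cast_natCast]
      rfl
    rw [← h1, h3, abs_of_nonneg (Nat.cast_nonneg _)]
    exact (hW a h2).trans (le_abs_self _)
  have hev := shiftDiff_iterate_eventually_eq_zero (N := natDim K n N + 1)
    (lt_of_le_of_lt (hPd.trans hWd) (by exact_mod_cast Nat.lt_succ_self _)) hP
  rw [hH] at hev
  obtain ⟨a₁, ha₁⟩ := Filter.eventually_atTop.mp hev
  refine (Set.finite_Icc a₀ a₁).subset fun a ha => ⟨?_, ?_⟩
  · by_contra hlt
    exact ha (shiftDiff_iterate_eq_zero_of_lt (a₀ := a₀) (fun b hb => by simp [hh, h0 b hb]) _ a (by omega))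
  · by_contra hlt
    exact ha (ha₁ a (by omega))

end Growth

/-! ### The grading of a single row. -/

section RowGrading

variable {K : Type*} [Field K] {n m : ℕ} {p : Fin m → ℕ} {M : Type*} [AddCommGroup M] [Module K M]
  [Module (SRing K n) M] [Module (ARing K n m) M] [IsScalarTower K (SRing K n) M]
  [IsScalarTower (SRing K n) (ARing K n m) M] {ℳ : ℤ × ℤ → Submodule K M}
  [SetLike.GradedSMul (bigrading K n p) ℳ]

theorem map_rowGrading (k a : ℤ) :
    (rowGrading n p ℳ k a).map ((row n p ℳ k).subtype.restrictScalars K) = ℳ (a, k) := by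
  refine le_antisymm (Submodule.map_comap_le _ _) fun x hx => ?_
  exact ⟨⟨x, component_le_row a k x hx⟩, hx, rfl⟩

theorem finrank_rowGrading (k a : ℤ) :
    Module.finrank K (rowGrading n p ℳ k a) = Module.finrank K (ℳ (a, k)) := by
  rw [← map_rowGrading (n := n) (p := p) (ℳ := ℳ) k a]
  exact ((rowGrading n p ℳ k a).equivMapOfInjective _ Subtype.val_injective).finrank_eq

theorem finiteDimensional_rowGrading (k a : ℤ) [FiniteDimensional K (ℳ (a, k))] :
    FiniteDimensional K (rowGrading n p ℳ k a) := by
  have : FiniteDimensional K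
      ((rowGrading n p ℳ k a).map ((row n p ℳ k).subtype.restrictScalars K)) := by
    rw [map_rowGrading]
    infer_instance
  exact Module.Finite.equiv ((rowGrading n p ℳ k a).equivMapOfInjective
    ((row n p ℳ k).subtype.restrictScalars K) Subtype.val_injective).symm

theorem rowGrading_eq_bot {k a : ℤ} (h : ℳ (a, k) = ⊥) : rowGrading n p ℳ k a = ⊥ := by
  rw [eq_bot_iff]
  intro x hx
  have hx' : (x : M) ∈ ℳ (a, k) := hx
  rw [h, Submodule.mem_bot] at hx'
  exact Subtype.ext hx'

theorem iSupIndep_rowGrading (hℳ : iSupIndep ℳ) (k : ℤ) : iSupIndep (rowGrading n p ℳ k) := by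
  intro a
  rw [Submodule.disjoint_def]
  intro x hx hx'
  have h1 : (x : M) ∈ ⨆ g, ⨆ (_ : g ≠ (a, k)), ℳ g := by
    have h2 := Submodule.mem_map_of_mem (f := (row n p ℳ k).subtype.restrictScalars K) hx'
    simp only [Submodule.map_iSup, map_rowGrading] at h2
    refine (iSup₂_le fun b hb => ?_ : (⨆ b, ⨆ (_ : b ≠ a), ℳ (b, k)) ≤ _) h2
    exact le_iSup₂_of_le (b, k) (by simpa using hb) le_rfl
  exact Subtype.ext (Submodule.disjoint_def.mp (hℳ (a, k)) x hx h1)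

theorem iSup_rowGrading (k : ℤ) : (⨆ a, rowGrading n p ℳ k a) = ⊤ := by
  rw [eq_top_iff]
  intro x _
  have hx : (x : M) ∈ ⨆ a, ℳ (a, k) := x.2
  simp only [← map_rowGrading (n := n) (p := p) (ℳ := ℳ) k, ← Submodule.map_iSup] at hx
  obtain ⟨y, hy, hyx⟩ := hx
  have : y = x := Subtype.ext hyx
  exact this ▸ hy

theorem isStable_rowGrading (k : ℤ) : IsStable (fun _ : Fin n => (1 : ℤ)) (rowGrading n p ℳ k) := by
  intro i a x hx
  have h := isStable_of_gradedSMul (n := n) p ℳ (Sum.inl i) (a, k) (x : M) hx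
  rw [X_smul_eq] at h
  have e : ((a, k) : ℤ × ℤ) + bidegree n p (Sum.inl i) = (a + 1, k) := by simp [bidegree]
  rw [e] at h
  exact h

end RowGrading

/-! ### The recurrence satisfied by the rows. -/

section Numerators

theorem shiftDiffs_replicate_apply (r : ℕ) (F : ℤ × ℤ → ℤ) (a k : ℤ) :
    shiftDiffs (List.replicate r ((1 : ℤ), (0 : ℤ))) F (a, k) =
      (shiftDiff 1)^[r] (fun a => F (a, k)) a := by
  induction r generalizing a with
  | zero => rfl
  | succ r ih =>
    rw [List.replicate_succ, shiftDiffs_cons, Function.iterate_succ_apply', shiftDiff, shiftDiff,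
      ← ih, ← ih]
    simp

/-- The weights `p` are nonnegative, so the operators only look further left. -/
theorem shiftDiffs_eq_zero_of_lt (l : List ℕ) {F : ℤ × ℤ → ℤ} {a₀ : ℤ}
    (h0 : ∀ a < a₀, ∀ k, F (a, k) = 0) :
    ∀ a < a₀, ∀ k, shiftDiffs (l.map fun p : ℕ => ((p : ℤ), (1 : ℤ))) F (a, k) = 0 := by
  induction l with
  | nil => exact h0
  | cons p l ih =>
    intro a ha k
    rw [List.map_cons, shiftDiffs_cons, shiftDiff, ih a ha k, Prod.mk_sub_mk,
      ih (a - p) (by omega) (k - 1), sub_zero]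

/-- A function on `ℤ × ℤ` whose generating function has denominator
`(1 - s) ^ n ∏ (1 - s ^ p t)`: the numerators of its rows satisfy a linear recurrence. -/
theorem shiftDiffs_eq_zero_of_finite_support (n : ℕ) (l : List ℕ) {F : ℤ × ℤ → ℤ} {a₀ : ℤ}
    (h0 : ∀ a < a₀, ∀ k, F (a, k) = 0)
    (hfin : (shiftDiffs (List.replicate n ((1 : ℤ), (0 : ℤ)) ++
      l.map fun p : ℕ => ((p : ℤ), (1 : ℤ))) F).support.Finite) :
    ∃ k₁, ∀ k ≥ k₁, ∀ a, shiftDiffs (l.map fun p : ℕ => ((p : ℤ), (1 : ℤ))) F (a, k) = 0 := by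
  obtain ⟨b, hb⟩ := (hfin.image Prod.snd).bddAbove
  -- Above the finite support, the n-th difference in a of the row is zero, and the row vanishes on
  -- the far left, so (1-s)^n can be cancelled.
  refine ⟨b + 1, fun k hk => congrFun (eq_zero_of_shiftDiff_iterate_eq_zero
    (fun a ha => shiftDiffs_eq_zero_of_lt l h0 a ha k) n ?_)⟩
  funext a
  rw [← shiftDiffs_replicate_apply, ← shiftDiffs_append]
  by_contra hne
  have : k ≤ b := hb ⟨(a, k), hne, rfl⟩
  omega

end Numerators

end BigradedHilbert

/-! ### Assembly of the theorem. -/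

theorem theorem2p2 {K : Type*} [Field K] {n m : ℕ} (p : Fin m → ℕ)
    {M : Type*} [AddCommGroup M] [Module K M] [Module (BigradedHilbert.SRing K n) M]
    [Module (BigradedHilbert.ARing K n m) M]
    [IsScalarTower K (BigradedHilbert.SRing K n) M]
    [IsScalarTower K (BigradedHilbert.ARing K n m) M]
    [IsScalarTower (BigradedHilbert.SRing K n) (BigradedHilbert.ARing K n m) M]
    [Module.Finite (BigradedHilbert.ARing K n m) M]
    (ℳ : ℤ × ℤ → Submodule K M) (hℳ : DirectSum.IsInternal ℳ)
    [SetLike.GradedSMul (BigradedHilbert.bigrading K n p) ℳ] :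
    ∃ k₀ : ℤ,
      -- the dimension of `M_k` is eventually constant, with value `ldim M`
      (∀ k ≥ k₀, Module.supportDim (BigradedHilbert.SRing K n) (BigradedHilbert.row n p ℳ k)
        = BigradedHilbert.ldim n p ℳ) ∧
      -- the iterated Hilbert coefficients of `M_k` exist
      (∀ k ≥ k₀, ∀ i : ℕ, BigradedHilbert.IsHilbertCoeffs n (BigradedHilbert.rowGrading n p ℳ k) i
        (BigradedHilbert.hilbertCoeff n (BigradedHilbert.rowGrading n p ℳ k) i)) ∧
      -- they are polynomials in `k` of bounded degree
      ∀ i j : ℕ, ∃ Q : ℚ[X],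
        (∀ k ≥ k₀, (BigradedHilbert.hilbertCoeff n (BigradedHilbert.rowGrading n p ℳ k) i j : ℚ)
          = Q.eval (k : ℚ)) ∧
        ((j : WithBot ℕ∞) < BigradedHilbert.ldim n p ℳ + (i : WithBot ℕ∞) →
          Q.degree < ((m + j : ℕ) : WithBot ℕ)) ∧
        (BigradedHilbert.ldim n p ℳ + (i : WithBot ℕ∞) ≤ (j : WithBot ℕ∞) → Q = 0) := by
  open BigradedHilbert in
  have hind := hℳ.submodule_iSupIndep
  have hst := isStable_of_gradedSMul (n := n) p ℳ
  obtain ⟨t, deg, hdeg, ht⟩ := exists_homogeneous_generators (K := K) (ι := Fin n ⊕ Fin m)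
    hℳ.submodule_iSup_eq_top
  obtain ⟨a₀, b₀, h0⟩ := exists_lower_bounds hind hst hdeg ht
  have hfd : ∀ g, FiniteDimensional K (ℳ g) := finiteDimensional_component hind hst hdeg ht
  obtain ⟨k₁, δ, hδ⟩ := exists_supportDim_row_eq (p := p) hind hdeg ht
  have hldim : ldim n p ℳ = δ := by
    refine (Filter.limsup_congr (v := fun _ => δ) ?_).trans (Filter.limsup_const δ)
    filter_upwards [Filter.eventually_ge_atTop k₁] with k hk using hδ k hk
  set F : ℤ × ℤ → ℤ := fun g => (Module.finrank K (ℳ g) : ℤ) with hF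
  have hF0 : ∀ a < a₀, ∀ k, F (a, k) = 0 := fun a ha k => by simp [hF, h0 a k (Or.inl ha)]
  -- For δ = ⊥ this takes the default value 0; that case is treated apart at the end.
  set d : ℕ := (δ.unbotD 0).toNat with hd
  have hnat : ∀ k ≥ k₁, natDim K n (row n p ℳ k) = d := fun k hk => by rw [natDim, hδ k hk]
  have hrow : ∀ k, (fun a => (Module.finrank K (rowGrading n p ℳ k a) : ℤ)) = fun a => F (a, k) :=
    fun k => funext fun a => by rw [finrank_rowGrading]
  have hfin : ∀ k ≥ k₁, ((shiftDiff 1)^[d] fun a => F (a, k)).support.Finite := fun k hk => by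
    have : Module.Finite (SRing K n) (row n p ℳ k) :=
      Module.Finite.iff_fg.mpr (row_fg hind hdeg ht k)
    have : ∀ a, FiniteDimensional K (rowGrading n p ℳ k a) :=
      fun a => finiteDimensional_rowGrading k a
    rw [← hnat k hk, ← hrow]
    exact finite_support_shiftDiff_iterate_natDim (iSupIndep_rowGrading hind k)
      (iSup_rowGrading k) (isStable_rowGrading k)
      (fun a ha => rowGrading_eq_bot (h0 a k (Or.inl ha)))
  have hserre := finite_support_shiftDiffs_finrank hind hst
    (l := (List.finRange n).map Sum.inl ++ (List.finRange m).map Sum.inr) (by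
      rintro (i | j) <;> simp)
  have hweights : ((List.finRange n).map Sum.inl ++ (List.finRange m).map Sum.inr).map
      (bidegree n p) = List.replicate n ((1 : ℤ), (0 : ℤ)) ++
        ((List.finRange m).map p).map fun p : ℕ => ((p : ℤ), (1 : ℤ)) := by
    rw [List.map_append, List.map_map, List.map_map, List.map_map]
    congr 1
    rw [List.eq_replicate_iff]
    refine ⟨by simp, fun x hx => ?_⟩
    obtain ⟨i, -, rfl⟩ := List.mem_map.mp hx
    rfl
  rw [hweights] at hserre
  obtain ⟨k₂, hrec⟩ := shiftDiffs_eq_zero_of_finite_support n _ hF0 hserre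
  -- The numerators of all rows at once; from `k₁` on each row has finite support by `hfin`. Since
  -- difference operators commute, `q` inherits the recurrence of `F`.
  let q : ℤ × ℤ → ℤ := shiftDiffs (List.replicate d ((1 : ℤ), (0 : ℤ))) F
  have hq : ∀ k, (fun a => q (a, k)) = (shiftDiff 1)^[d] fun a => F (a, k) :=
    fun k => funext fun a => shiftDiffs_replicate_apply d F a k
  obtain ⟨k₀, hk₀, hpoly⟩ := exists_polynomial_binomMoment ((List.finRange m).map p) (f := q)
    (k₁ := max k₁ k₂) (fun k hk => by
      rw [hq]
      exact hfin k (le_trans (le_max_left _ _) hk)) (fun k hk a => by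
      rw [shiftDiffs_comm, shiftDiffs_replicate_apply]
      have : (fun a => shiftDiffs (((List.finRange m).map p).map
          fun p : ℕ => ((p : ℤ), (1 : ℤ))) F (a, k)) = 0 :=
        funext fun a => hrec k (le_trans (le_max_right _ _) hk) a
      rw [this]
      exact shiftDiff_iterate_eq_zero_of_lt (a₀ := a + 1) (fun _ _ => rfl) d a (by omega))
  have hk₁ : ∀ k ≥ k₀, k ≥ k₁ := fun k hk => le_trans (le_max_left _ _) (le_trans hk₀ hk)
  have hcoeffs : ∀ k ≥ k₀, ∀ i, IsHilbertCoeffs n (rowGrading n p ℳ k) i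
      fun j => if j < d + i then binomMoment (fun a => q (a, k)) j else 0 := fun k hk i => by
    have h1 := hfin k (hk₁ k hk)
    rw [← hnat k (hk₁ k hk), ← hrow] at h1
    have h2 := isHilbertCoeffs_of_finite_support n (a₀ := a₀)
      (fun a ha => rowGrading_eq_bot (h0 a k (Or.inl ha))) h1 i
    rwa [hrow, hnat k (hk₁ k hk), ← hq] at h2
  refine ⟨k₀, fun k hk => (hδ k (hk₁ k hk)).trans hldim.symm, fun k hk i => ?_, fun i j => ?_⟩
  · rw [(hcoeffs k hk i).hilbertCoeff_eq]
    exact hcoeffs k hk i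
  · rw [hldim]
    have hcoeff : ∀ k ≥ k₀, hilbertCoeff n (rowGrading n p ℳ k) i j =
        if j < d + i then binomMoment (fun a => q (a, k)) j else 0 :=
      fun k hk => congrFun (hcoeffs k hk i).hilbertCoeff_eq j
    -- Here ⊥ + i = ⊥, so `Q` must be 0 for every j, although j < d + i may hold with the default d
    -- = 0. The rows are zero, hence so are the moments.
    by_cases hbot : δ = ⊥
    · refine ⟨0, fun k hk => ?_, fun _ => by simp, fun _ => rfl⟩
      have hsub : Subsingleton (row n p ℳ k) :=
        (Module.supportDim_eq_bot_iff_subsingleton (SRing K n) _).mp ((hδ k (hk₁ k hk)).trans hbot)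
      have hz : (fun a => F (a, k)) = 0 := by
        rw [← hrow]
        funext a
        simp [Module.finrank_zero_of_subsingleton]
      rw [hcoeff k hk, hq, hz]
      have : (shiftDiff 1)^[d] (0 : ℤ → ℤ) = 0 := funext fun a =>
        shiftDiff_iterate_eq_zero_of_lt (a₀ := a + 1) (fun _ _ => rfl) d a (by omega)
      rw [this, binomMoment_zero]
      simp
    · have hδd : δ = (d : WithBot ℕ∞) := by
        have : Nontrivial (row n p ℳ k₀) :=
          (Module.supportDim_ne_bot_iff_nontrivial (SRing K n) _).mp
            (by rw [hδ k₀ (hk₁ k₀ le_rfl)]; exact hbot)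
        rw [← hδ k₀ (hk₁ k₀ le_rfl), supportDim_eq_natDim, hnat k₀ (hk₁ k₀ le_rfl)]
      have hlt : (j : WithBot ℕ∞) < δ + (i : WithBot ℕ∞) ↔ j < d + i := by
        rw [hδd]
        exact_mod_cast Iff.rfl
      by_cases hj : j < d + i
      · obtain ⟨Q, hQd, hQ⟩ := hpoly j
        refine ⟨Q, fun k hk => by rw [hcoeff k hk, if_pos hj, hQ k hk], fun _ => ?_, fun h => ?_⟩
        · simpa using hQd
        · exact absurd (hlt.mpr hj) (not_lt.mpr h)
      · exact ⟨0, fun k hk => by rw [hcoeff k hk, if_neg hj]; simp, fun _ => by simp, fun _ => rfl⟩
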